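/- Let $d\ge 2$ and let $\Omega\subset\mathbb R^d$ be a bounded domain with smooth boundary. Consider on $\Omega\times[0,T)$, $0<T\le\infty$, the barotropic compressible Navier–Stokes system $$\rho_t+\operatorname{div}(\rho u)=0,\qquad (\rho u)_t+\operatorname{div}(\rho u\otimes u)-\operatorname{div}(2\mu(\rho)D(u))-\nabla(\lambda(\rho)\operatorname{div}u)+\nabla\rho^\gamma=0,$$ where $D(u)=\tfrac12(\nabla u+\nabla u^{\top})$, $\gamma>1$, $\mu(\rho)=a\rho^\alpha$, $\lambda(\rho)=b\rho^\beta$ with $a>0$, $2a+db\ge 0$, and $\mu(s)\ge0$, $2\mu(s)+d\lambda(s)\ge 0$ for all $s\ge0$. A classical solution on $\Omega\times[0,T)$ with initial data $(\rho_0,u_0)$ is a pair $(\rho,u)$ with $\rho\ge0$, $\rho\in C^1(\Omega\times[0,T))$ and $u\in C^1([0,T);C^2(\Omega))$, where $C^2(\Omega)$ is the space of twice continuously differentiable fields that are bounded on $\Omega$ together with their derivatives of order at most two, with the supremum norm, such that the system holds at every point of $\Omega\times[0,T)$ (the tensor $\mu(\rho)D(u)$ and the function $\lambda(\rho)\operatorname{div}u$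 being differentiable in $x$), $(\rho,u)|_{t=0}=(\rho_0,u_0)$ in $\Omega$, and a boundary condition holds under which no fluid leaves $\Omega$: $u(\cdot,t)$ is continuous on $\overline\Omega$ and $u\cdot n\le 0$ on $\partial\Omega$, with $n$ the outward unit normal. (This includes the no-slip condition and every condition that contains $u\cdot n=0$, such as Navier slip.) Suppose that $(U,V)$ is an isolated mass group of $\rho_0$: $U,V$ are bounded open sets, $\overline V\subset U$, $\overline U\subset\Omega$, $U$ is connected, $\rho_0=0$ on $U\setminus V$, and $\int_V\rho_0\,dx>0$. Put $M_0=\int_V\rho_0\,dx$, $$E_0=\int_V\Big(\tfrac12\rho_0|u_0|^2+\tfrac{1}{\gamma-1}\rho_0^\gamma\Big)dx,\qquad E_1=\int_V\Big(\tfrac12\rho_0\,|u_0+2\mu'(\rho_0)\nabla\log\rho_0|^2+\tfrac1{\gamma-1}\rho_0^\gamma\Big)dx,$$ where the first summand of the last integrand is $0$ at points with $\rho_0=0$. Assume that one of the following holds: (1) $\alpha=\beta>0$, $2a+db=0$, and $M_0$ is finite; (2) $\alpha,\beta\in(0,\gamma]$, and $M_0,E_0$ are finite; (3) $\alpha=\beta\in(\gamma,\kappa\gamma]$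 and $b=2a(\alpha-1)$, where $\kappa$ is some number in $[1,2)$ if $d=2$ and $\kappa=\frac{d+2}{d}$ if $d\ge3$, and $M_0,E_0,E_1$ are finite. Then every classical solution with initial data $(\rho_0,u_0)$ blows up in finite time: there is $T^*<\infty$, determined by $\Omega$, $\gamma$, $a,b,\alpha,\beta$, $\rho_0,u_0,U,V$, such that every classical solution on $\Omega\times[0,T)$ with these initial data has $T\le T^*$. In particular there is no global classical solution. -/

import Mathlib

open Set Filter Topology MeasureTheory
open scoped ENNReal ContDiff

noncomputable section

namespace BarotropicNS

/-- Physical space `ℝ^d` with the Euclidean norm. -/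
abbrev Space (d : ℕ) : Type := EuclideanSpace ℝ (Fin d)

variable {d : ℕ}

/-! ### Smooth bounded domains -/

/-- `φ` is a smooth local defining function of `Ω` at `x`: near `x` the set `Ω` is `{φ < 0}`, and the
differential of `φ` does not vanish at `x`. -/
def IsDefiningFunctionAt (Ω : Set (Space d)) (x : Space d) (φ : Space d → ℝ) : Prop :=
  ContDiff ℝ ∞ φ ∧ gradient φ x ≠ 0 ∧ ∀ᶠ y in 𝓝 x, (y ∈ Ω ↔ φ y < 0)

/-- A bounded domain (open connected set) of `ℝ^d` with smooth boundary. -/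
structure IsSmoothBoundedDomain (Ω : Set (Space d)) : Prop where
  isOpen : IsOpen Ω
  isConnected : IsConnected Ω
  isBounded : Bornology.IsBounded Ω
  smooth_boundary : ∀ x ∈ frontier Ω, ∃ φ, IsDefiningFunctionAt Ω x φ

/-- `n` is the outward unit normal to `∂Ω` at `x`. -/
def IsOuterUnitNormal (Ω : Set (Space d)) (x n : Space d) : Prop :=
  ∃ φ, IsDefiningFunctionAt Ω x φ ∧ n = ‖gradient φ x‖⁻¹ • gradient φ x

/-! ### Differential operators in the space variable -/

/-- The partial derivative `∂_i f (x)`. -/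
def pd (i : Fin d) (f : Space d → ℝ) (x : Space d) : ℝ :=
  fderiv ℝ f x (EuclideanSpace.single i 1)

/-- The divergence of a vector field. -/
def divg (v : Space d → Space d) (x : Space d) : ℝ :=
  ∑ i, pd i (fun y => v y i) x

/-- The `(i, j)` entry of the strain tensor `D(v) = (∇v + ∇vᵀ) / 2`. -/
def strain (v : Space d → Space d) (i j : Fin d) (x : Space d) : ℝ :=
  (pd j (fun y => v y i) x + pd i (fun y => v y j) x) / 2

/-! ### Function spaces -/

/-- The time interval `[0, T)`, where `T = ∞` is allowed. -/
def timeInterval (T : EReal) : Set ℝ := {t | 0 ≤ t ∧ (t : EReal) < T}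

/-- The norm of `C²(Ω)`, with values in `[0, ∞]`. -/
def C2Norm (Ω : Set (Space d)) (f : Space d → Space d) : ℝ≥0∞ :=
  ⨆ x ∈ Ω, ENNReal.ofReal (‖f x‖ + ‖fderiv ℝ f x‖ + ‖fderiv ℝ (fderiv ℝ f) x‖)

/-- Membership in the normed space `C²(Ω)`. -/
def MemC2 (Ω : Set (Space d)) (f : Space d → Space d) : Prop :=
  ContDiffOn ℝ 2 f Ω ∧ C2Norm Ω f < ⊤

/-- `u ∈ C¹([0, T); C²(Ω))`: the curve `t ↦ u t` in the normed space `C²(Ω)` has a derivative `v`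
(one-sided at `t = 0`), and `v` is continuous. -/
def MemC1C2 (Ω : Set (Space d)) (T : EReal) (u : ℝ → Space d → Space d) : Prop :=
  ∃ v : ℝ → Space d → Space d,
    (∀ t ∈ timeInterval T, MemC2 Ω (u t) ∧ MemC2 Ω (v t)) ∧
    (∀ t ∈ timeInterval T,
      Tendsto (fun s => C2Norm Ω (fun x => (s - t)⁻¹ • (u s x - u t x) - v t x))
        (𝓝[timeInterval T \ {t}] t) (𝓝 0)) ∧
    (∀ t ∈ timeInterval T,
      Tendsto (fun s => C2Norm Ω (fun x => v s x - v t x)) (𝓝[timeInterval T] t) (𝓝 0))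

/-! ### The barotropic compressible Navier-Stokes system -/

/-- Pointwise validity, at the time `t` and the point `x`, of the continuity equation
`ρ_t + div (ρ u) = 0` and the momentum equation
`(ρ u)_t + div (ρ u ⊗ u) - div (2 μ(ρ) D(u)) - ∇ (λ(ρ) div u) + ∇ ρ^γ = 0`
on the time interval `I`. The viscous stresses are required to be differentiable, so that the
viscous terms exist. -/
structure SolvesAt (γ : ℝ) (μ lam : ℝ → ℝ) (I : Set ℝ) (ρ : ℝ → Space d → ℝ)
    (u : ℝ → Space d → Space d) (t : ℝ) (x : Space d) : Prop where
  shear_stress_differentiable :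
    ∀ i j, DifferentiableAt ℝ (fun y => 2 * μ (ρ t y) * strain (u t) i j y) x
  bulk_stress_differentiable :
    DifferentiableAt ℝ (fun y => lam (ρ t y) * divg (u t) y) x
  continuity_eq :
    derivWithin (fun s => ρ s x) I t + divg (fun y => ρ t y • u t y) x = 0
  momentum_eq : ∀ i,
    derivWithin (fun s => ρ s x * u s x i) I t
      + ∑ j, pd j (fun y => ρ t y * u t y i * u t y j) x
      - ∑ j, pd j (fun y => 2 * μ (ρ t y) * strain (u t) i j y) x
      - pd i (fun y => lam (ρ t y) * divg (u t) y) x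
      + pd i (fun y => ρ t y ^ γ) x = 0

/-- `(ρ, u)` is a classical solution on `Ω × [0, T)` with initial data `(ρ₀, u₀)`, for a boundary
condition under which no fluid leaves `Ω`: the velocity is continuous up to the boundary and
`u · n ≤ 0` on `∂Ω`. -/
structure IsClassicalSolution (Ω : Set (Space d)) (γ : ℝ) (μ lam : ℝ → ℝ)
    (ρ₀ : Space d → ℝ) (u₀ : Space d → Space d) (T : EReal)
    (ρ : ℝ → Space d → ℝ) (u : ℝ → Space d → Space d) : Prop where
  time_pos : 0 < T
  density_regular : ContDiffOn ℝ 1 (fun p : ℝ × Space d => ρ p.1 p.2) (timeInterval T ×ˢ Ω)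
  velocity_regular : MemC1C2 Ω T u
  density_nonneg : ∀ t ∈ timeInterval T, ∀ x ∈ Ω, 0 ≤ ρ t x
  solves : ∀ t ∈ timeInterval T, ∀ x ∈ Ω, SolvesAt γ μ lam (timeInterval T) ρ u t x
  initial_density : ∀ x ∈ Ω, ρ 0 x = ρ₀ x
  initial_velocity : ∀ x ∈ Ω, u 0 x = u₀ x
  velocity_continuous : ∀ t ∈ timeInterval T, ContinuousOn (u t) (closure Ω)
  no_outflow : ∀ t ∈ timeInterval T, ∀ x ∈ frontier Ω, ∀ n, IsOuterUnitNormal Ω x n →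
    inner ℝ (u t x) n ≤ 0

/-! ### Isolated mass groups and the initial quantities -/

/-- `(U, V)` is an isolated mass group of the density `ρ₀` in `Ω`. -/
structure IsIsolatedMassGroup (Ω : Set (Space d)) (ρ₀ : Space d → ℝ) (U V : Set (Space d)) :
    Prop where
  isOpen_U : IsOpen U
  isOpen_V : IsOpen V
  isBounded_U : Bornology.IsBounded U
  isBounded_V : Bornology.IsBounded V
  closure_V_subset : closure V ⊆ U
  closure_U_subset : closure U ⊆ Ω
  isConnected_U : IsConnected U
  vacuum : ∀ x ∈ U \ V, ρ₀ x = 0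
  mass_pos : 0 < ∫ x in V, ρ₀ x

/-- The energy density `½ ρ₀ |u₀|² + ρ₀^γ / (γ - 1)`, whose integral over `V` is `E₀`. -/
def energyDensity (γ : ℝ) (ρ₀ : Space d → ℝ) (u₀ : Space d → Space d) (x : Space d) : ℝ :=
  1 / 2 * ρ₀ x * ‖u₀ x‖ ^ 2 + 1 / (γ - 1) * ρ₀ x ^ γ

/-- The Bresch-Desjardins entropy density `½ ρ₀ |u₀ + 2 μ'(ρ₀) ∇ log ρ₀|² + ρ₀^γ / (γ - 1)`, whose
integral over `V` is `E₁`. At a vacuum point the first summand is `0`, because of its factor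
`ρ₀`. -/
def bdEntropyDensity (γ : ℝ) (μ : ℝ → ℝ) (ρ₀ : Space d → ℝ) (u₀ : Space d → Space d)
    (x : Space d) : ℝ :=
  1 / 2 * ρ₀ x * ‖u₀ x + (2 * deriv μ (ρ₀ x)) • gradient (fun y => Real.log (ρ₀ y)) x‖ ^ 2
    + 1 / (γ - 1) * ρ₀ x ^ γ

/-! ### The conditions on the viscosity exponents -/

/-- Condition (i). -/
def ConditionI (d : ℕ) (a b α β : ℝ) : Prop :=
  α = β ∧ 0 < α ∧ 2 * a + d * b = 0

/-- Condition (ii). -/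
def ConditionII (γ α β : ℝ) : Prop :=
  α ∈ Ioc 0 γ ∧ β ∈ Ioc 0 γ

/-- The admissible values of `κ`: any `κ ∈ [1, 2)` if `d = 2`, and `κ = (d + 2) / d` if `d ≥ 3`. -/
def AdmissibleKappa (d : ℕ) (κ : ℝ) : Prop :=
  (d = 2 ∧ κ ∈ Ico 1 2) ∨ (3 ≤ d ∧ κ = ((d : ℝ) + 2) / d)

/-- Condition (iii). -/
def ConditionIII (d : ℕ) (γ a b α β : ℝ) : Prop :=
  α = β ∧ (∃ κ, AdmissibleKappa d κ ∧ α ∈ Ioc γ (κ * γ)) ∧ 2 * a * (α - 1) = b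

end BarotropicNS

end

/-!
Particles of an isolated mass group `V` stay inside the fluid domain and are surrounded by vacuum
for all times. On the region `A t` which they occupy, all boundary terms of the balance laws vanish,
because the stress is zero in the vacuum. So the mass `M` of the group is conserved, and with the
half moment of inertia `J = ∫ ρ |x|² / 2` and the virial `N = ∫ ρ u · x` one has
`J' = N` and `N' = ∫ (ρ |u|² + d ρ^γ - P(ρ) div u)`, where `P = 2 μ + d λ ≥ 0` is the viscous pressure.

By the renormalized continuity equation the viscous term is a time derivative: if `s G' - G = P`,
then `-∫ P(ρ) div u = d/dt ∫ G(ρ)`. The choice `G(s) = s ∫₁ˢ P(σ) / σ² dσ` is bounded from below,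
since `P` is nonnegative, and bounded on `[0, 1]`. Hence `N t ≥ -K + d ∫₀ᵗ ∫ ρ^γ`, with `K`
determined by the data, and `∫ ρ^γ` has a positive lower bound in terms of `M` and the volume of `Ω`. So `N` grows at least
linearly and `J` quadratically, while `J ≤ M sup_Ω |x|² / 2`; this bounds the lifespan. The argument
works for all continuous `μ`, `λ` that vanish in the vacuum, with `P ≥ 0` (`exists_lifespan_bound`);
each of the three conditions on the exponents provides such viscosities.

The technical work consists of three points.
* `exists_label` and `exists_isIsolatedRegion`: the flow does not reach the boundary, since at the
  nearest boundary point `z` the outer normal is `(z - x) / |z - x|`, so that the distance to the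
  complement of `Ω` decays at most exponentially along trajectories.
* `IsIsolatedRegion.hasDerivAt_integral`: the transport theorem. Since a fixed cutoff function can
  be used locally in time, no regularity of `A t` and no Jacobian of the flow enters. The viscous
  stress is differentiable only pointwise, but its divergence is continuous by the momentum equation,
  which is enough for the divergence theorem in Mathlib.
* `exists_viscous_potential`: to have `G` continuously differentiable up to the vacuum, `P` is
  replaced by `max (P - η) 0`, which vanishes near `0`; the error is controlled by `η`.
-/

namespace BarotropicNS

variable {d : ℕ}

/-! ### The divergence theorem for compactly supported fields -/

/-- The divergence of a compactly supported, everywhere differentiable field integrates to zero.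
Only the divergence, and not the single partial derivatives, has to be integrable. -/
theorem integral_divg_eq_zero {W : Space d → Space d} (hW : Differentiable ℝ W)
    (hcs : HasCompactSupport W) (hint : Integrable (divg W)) : ∫ x, divg W x = 0 := by
  rcases d with _ | n
  · simp [divg]
  -- The support lies in a box, on whose faces the field vanishes.
  obtain ⟨R, hR⟩ := hcs.isBounded.subset_closedBall (0 : Space (n + 1))
  set r : ℝ := |R| + 1 with hr
  have hr0 : 0 < r := by positivity
  have hzero : ∀ x : Space (n + 1), ∀ i, r ≤ |x i| → W x = 0 := by
    intro x i hx
    by_contra hne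
    have h1 : x ∈ Metric.closedBall (0 : Space (n + 1)) R :=
      hR (subset_tsupport _ (Function.mem_support.2 hne))
    have h2 : |x i| ≤ ‖x‖ := by simpa using PiLp.norm_apply_le x i
    rw [mem_closedBall_zero_iff] at h1
    have := le_abs_self R
    linarith
  let e : (Fin (n + 1) → ℝ) →L[ℝ] Space (n + 1) :=
    (PiLp.continuousLinearEquiv 2 ℝ (fun _ : Fin (n + 1) => ℝ)).symm.toContinuousLinearMap
  have he : ∀ y i, e y i = y i := fun y i => rfl
  let f : (Fin (n + 1) → ℝ) → (Fin (n + 1) → ℝ) := fun y i => W (e y) i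
  let f' : (Fin (n + 1) → ℝ) → (Fin (n + 1) → ℝ) →L[ℝ] (Fin (n + 1) → ℝ) := fun y =>
    ContinuousLinearMap.pi fun i => (fderiv ℝ (fun x => W x i) (e y)).comp e
  have hWi : ∀ i, Differentiable ℝ (fun x => W x i) := fun i x =>
    (differentiableAt_piLp 2).1 (hW x) i
  have hf : ∀ y, HasFDerivAt f (f' y) y := by
    intro y
    refine hasFDerivAt_pi.2 fun i => ?_
    exact ((hWi i (e y)).hasFDerivAt).comp y e.hasFDerivAt
  have hdiv : ∀ y, ∑ i, f' y (Pi.single i 1) i = divg W (e y) := by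
    intro y
    rfl
  have hmp : MeasurePreserving e volume volume := PiLp.volume_preserving_toLp (Fin (n + 1))
  have hemb : MeasurableEmbedding e :=
    (PiLp.continuousLinearEquiv 2 ℝ
      (fun _ : Fin (n + 1) => ℝ)).symm.toHomeomorph.measurableEmbedding
  have key := integral_divergence_of_hasFDerivAt_off_countable (fun _ : Fin (n + 1) => -r)
    (fun _ => r) (fun _ => by linarith) f f' ∅ countable_empty
    (fun y _ => (hf y).continuousAt.continuousWithinAt) (fun y _ => hf y)
    (by
      simp only [hdiv]
      exact ((hmp.integrable_comp_emb hemb).2 hint).integrableOn)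
  have hrhs : ∀ i : Fin (n + 1), ∀ c : ℝ, r ≤ |c| → ∀ x : Fin n → ℝ,
      f (i.insertNth c x) i = 0 := by
    intro i c hc x
    have : W (e (i.insertNth c x)) = 0 := hzero _ i (by simpa [he] using hc)
    simp [f, this]
  have h0 : ∫ y in Icc (fun _ : Fin (n + 1) => -r) (fun _ => r), divg W (e y) = 0 := by
    simp only [hdiv] at key
    rw [key]
    refine Finset.sum_eq_zero fun i _ => ?_
    rw [integral_congr_ae (g := fun _ => 0)
        (Eventually.of_forall fun x => hrhs i r (le_abs_self r) x),
      integral_congr_ae (g := fun _ => 0)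
        (Eventually.of_forall fun x => hrhs i (-r) (by rw [abs_neg]; exact le_abs_self r) x)]
    simp
  rw [← hmp.integral_comp hemb, ← h0, setIntegral_eq_integral_of_forall_compl_eq_zero]
  intro y hy
  have : ∃ i, r < |y i| := by
    by_contra! hcon
    exact hy ⟨fun i => (abs_le.1 (hcon i)).1, fun i => (abs_le.1 (hcon i)).2⟩
  obtain ⟨i, hi⟩ := this
  -- Near such a point the field vanishes, and so does its divergence.
  have hev : W =ᶠ[𝓝 (e y)] fun _ => 0 := by
    have hop : IsOpen {x : Space (n + 1) | r < |x i|} :=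
      isOpen_lt continuous_const (by fun_prop)
    filter_upwards [hop.mem_nhds (by simpa [he] using hi)] with x hx
    exact hzero x i (le_of_lt hx)
  unfold divg pd
  refine Finset.sum_eq_zero fun j _ => ?_
  have : (fun x => W x j) =ᶠ[𝓝 (e y)] fun _ => (0 : ℝ) := by
    filter_upwards [hev] with x hx
    simp [hx]
  rw [this.fderiv_eq]
  simp

/-! ### Balance laws on moving regions -/

/-- A family of compact sets `A t ⊆ Ω`, `t ∈ [0, τ]`, that is separated by vacuum from the rest of
the fluid: near each time there is a cutoff function that is `1` around `A t` and on whose support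
`ρ t` vanishes outside `A t`. This encodes that `A` moves continuously and is surrounded by vacuum,
without any regularity of the boundary of `A t`. -/
structure IsIsolatedRegion (Ω : Set (Space d)) (τ : ℝ) (ρ : ℝ → Space d → ℝ)
    (A : ℝ → Set (Space d)) : Prop where
  isCompact : ∀ t ∈ Icc 0 τ, IsCompact (A t)
  subset : ∀ t ∈ Icc 0 τ, A t ⊆ Ω
  exists_cutoff : ∀ t₀ ∈ Icc 0 τ, ∃ χ : Space d → ℝ, ContDiff ℝ ∞ χ ∧ HasCompactSupport χ ∧
    tsupport χ ⊆ Ω ∧ ∀ᶠ t in 𝓝[Icc 0 τ] t₀,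
      (∀ x ∈ A t, χ =ᶠ[𝓝 x] 1) ∧ ∀ x ∈ tsupport χ, x ∉ A t → ρ t x = 0

/-- A product with a cutoff function supported in the open set `Ω` is continuous everywhere. -/
theorem continuousOn_cutoff_mul {X : Type*} [TopologicalSpace X] {Ω : Set (Space d)}
    (hΩ : IsOpen Ω) {χ : Space d → ℝ} (hχ : Continuous χ) (hsupp : tsupport χ ⊆ Ω)
    {I : Set X} {f : X → Space d → ℝ} (hf : ContinuousOn (Function.uncurry f) (I ×ˢ Ω)) :
    ContinuousOn (Function.uncurry fun t x => χ x * f t x) (I ×ˢ univ) := by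
  rintro ⟨t, x⟩ ⟨ht, -⟩
  by_cases hx : x ∈ Ω
  · have h1 : ContinuousWithinAt (Function.uncurry f) (I ×ˢ univ) (t, x) := by
      refine (hf (t, x) ⟨ht, hx⟩).mono_of_mem_nhdsWithin ?_
      have h2 : (univ : Set X) ×ˢ Ω ∈ 𝓝 (t, x) :=
        prod_mem_nhds univ_mem (hΩ.mem_nhds hx)
      filter_upwards [mem_nhdsWithin_of_mem_nhds h2, self_mem_nhdsWithin] with p hp hp'
      exact ⟨hp'.1, hp.2⟩
    exact (hχ.comp continuous_snd).continuousWithinAt.mul h1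
  · have hx' : x ∈ (tsupport χ)ᶜ := fun h => hx (hsupp h)
    have h2 : (univ : Set X) ×ˢ (tsupport χ)ᶜ ∈ 𝓝 (t, x) :=
      prod_mem_nhds univ_mem ((isClosed_tsupport χ).isOpen_compl.mem_nhds hx')
    have : (Function.uncurry fun t x => χ x * f t x) =ᶠ[𝓝 (t, x)] fun _ => 0 := by
      filter_upwards [h2] with p hp
      simp [Function.uncurry, image_eq_zero_of_notMem_tsupport hp.2]
    exact (continuousAt_const.congr this.symm).continuousWithinAt

theorem divg_smul {χ : Space d → ℝ} {w : Space d → Space d} {x : Space d}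
    (hχ : DifferentiableAt ℝ χ x) (hw : DifferentiableAt ℝ w x) :
    divg (fun y => χ y • w y) x = χ x * divg w x + fderiv ℝ χ x (w x) := by
  have hwi : ∀ i, DifferentiableAt ℝ (fun y => w y i) x := (differentiableAt_piLp 2).1 hw
  have hsum : w x = ∑ i, w x i • EuclideanSpace.single i (1 : ℝ) := by
    ext j
    simp [Finset.sum_apply, Pi.single_apply]
  unfold divg pd
  conv_rhs => rw [hsum, map_sum]
  rw [Finset.mul_sum, ← Finset.sum_add_distrib]
  refine Finset.sum_congr rfl fun i _ => ?_
  have : (fun y => (χ y • w y) i) = fun y => χ y * w y i := by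
    ext y
    simp
  rw [this, fderiv_fun_mul hχ (hwi i)]
  simp

theorem divg_congr {v w : Space d → Space d} {x : Space d} (h : v =ᶠ[𝓝 x] w) :
    divg v x = divg w x := by
  unfold divg pd
  refine Finset.sum_congr rfl fun i _ => ?_
  have : (fun y => v y i) =ᶠ[𝓝 x] fun y => w y i := by
    filter_upwards [h] with y hy
    rw [hy]
  rw [this.fderiv_eq]

/-- Integration by parts against a cutoff function. -/
theorem integral_cutoff_mul_divg {Ω : Set (Space d)} (hΩ : IsOpen Ω) {χ : Space d → ℝ}
    (hχ : ContDiff ℝ ∞ χ) (hcs : HasCompactSupport χ) (hsupp : tsupport χ ⊆ Ω)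
    {w : Space d → Space d} (hw : ∀ x ∈ Ω, DifferentiableAt ℝ w x)
    (hdiv : ContinuousOn (divg w) Ω) (hχw : ∀ x ∈ Ω, fderiv ℝ χ x (w x) = 0) :
    ∫ x, χ x * divg w x = 0 := by
  have hχd : Differentiable ℝ χ := hχ.differentiable (by simp)
  have hout : ∀ x, x ∉ Ω → (fun y => χ y • w y) =ᶠ[𝓝 x] fun _ => 0 := by
    intro x hx
    have hx' : x ∈ (tsupport χ)ᶜ := fun h => hx (hsupp h)
    filter_upwards [(isClosed_tsupport χ).isOpen_compl.mem_nhds hx'] with y hy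
    simp [image_eq_zero_of_notMem_tsupport hy]
  have heq : divg (fun y => χ y • w y) = fun x => χ x * divg w x := by
    ext x
    by_cases hx : x ∈ Ω
    · rw [divg_smul (hχd x) (hw x hx), hχw x hx, add_zero]
    · rw [divg_congr (hout x hx),
        image_eq_zero_of_notMem_tsupport (f := χ) fun h => hx (hsupp h)]
      simp [divg, pd]
  rw [← heq]
  refine integral_divg_eq_zero ?_ ?_ ?_
  · intro x
    by_cases hx : x ∈ Ω
    · exact (hχd x).smul (hw x hx)
    · exact (differentiableAt_const (0 : Space d)).congr_of_eventuallyEq (hout x hx)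
  · exact hcs.smul_right
  · rw [heq]
    have hc : Continuous fun x => χ x * divg w x := by
      have := continuousOn_cutoff_mul (X := Unit) (I := univ) hΩ hχ.continuous hsupp
        (f := fun _ => divg w)
        (hdiv.comp continuous_snd.continuousOn fun p hp => hp.2)
      rw [univ_prod_univ, continuousOn_univ] at this
      exact this.comp (Continuous.prodMk continuous_const continuous_id : Continuous fun x => ((), x))
    exact hc.integrable_of_hasCompactSupport hcs.mul_right

theorem setIntegral_eq_integral_cutoff_mul {A : Set (Space d)} {χ f r : Space d → ℝ}
    (hA : MeasurableSet A) (h1 : ∀ x ∈ A, χ =ᶠ[𝓝 x] 1)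
    (h0 : ∀ x ∈ tsupport χ, x ∉ A → r x = 0) (hf : ∀ x ∈ tsupport χ, r x = 0 → f x = 0) :
    ∫ x in A, f x = ∫ x, χ x * f x := by
  rw [← setIntegral_eq_integral_of_forall_compl_eq_zero (s := A) (f := fun x => χ x * f x)]
  · refine setIntegral_congr_fun hA fun x hx => ?_
    simp [(h1 x hx).eq_of_nhds]
  · intro x hx
    by_cases hxs : x ∈ tsupport χ
    · rw [hf x hxs (h0 x hxs hx), mul_zero]
    · rw [image_eq_zero_of_notMem_tsupport hxs, zero_mul]

section IsolatedRegion

variable {Ω : Set (Space d)} {τ : ℝ} {ρ : ℝ → Space d → ℝ} {A : ℝ → Set (Space d)}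

namespace IsIsolatedRegion

theorem continuousOn_integral (hΩ : IsOpen Ω) (hA : IsIsolatedRegion Ω τ ρ A)
    {f : ℝ → Space d → ℝ} (hfc : ContinuousOn (Function.uncurry f) (Icc 0 τ ×ˢ Ω))
    (hf0 : ∀ t ∈ Icc 0 τ, ∀ x ∈ Ω, ρ t x = 0 → f t x = 0) :
    ContinuousOn (fun t => ∫ x in A t, f t x) (Icc 0 τ) := by
  intro t₀ ht₀
  obtain ⟨χ, hχ, hcs, hsupp, hev⟩ := hA.exists_cutoff t₀ ht₀
  have hc : ContinuousOn (fun t => ∫ x, χ x * f t x) (Icc 0 τ) := by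
    refine continuousOn_integral_of_compact_support hcs
      (continuousOn_cutoff_mul hΩ hχ.continuous hsupp hfc) fun t x _ hx => ?_
    rw [image_eq_zero_of_notMem_tsupport hx, zero_mul]
  have hev' : ∀ᶠ t in 𝓝[Icc 0 τ] t₀, ∫ x in A t, f t x = ∫ x, χ x * f t x := by
    filter_upwards [hev, self_mem_nhdsWithin] with t ht htI
    exact setIntegral_eq_integral_cutoff_mul (hA.isCompact t htI).measurableSet ht.1 ht.2
      fun x hx => hf0 t htI x (hsupp hx)
  exact (hc t₀ ht₀).congr_of_eventuallyEq hev' (hev'.self_of_nhdsWithin ht₀)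

/-- **Transport theorem.** If `∂ₜf + div w = h` in `Ω`, and `f`, `w`, `h` vanish in the vacuum, then
`d/dt ∫_{A t} f = ∫_{A t} h`. The flux `w` has to be differentiable only pointwise. -/
theorem hasDerivAt_integral (hΩ : IsOpen Ω) (hA : IsIsolatedRegion Ω τ ρ A)
    {f ft h : ℝ → Space d → ℝ} {w : ℝ → Space d → Space d}
    (hfc : ContinuousOn (Function.uncurry f) (Icc 0 τ ×ˢ Ω))
    (hft : ∀ t ∈ Ioo 0 τ, ∀ x ∈ Ω, HasDerivAt (fun s => f s x) (ft t x) t)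
    (hftc : ContinuousOn (Function.uncurry ft) (Ioo 0 τ ×ˢ Ω))
    (hw : ∀ t ∈ Ioo 0 τ, ∀ x ∈ Ω, DifferentiableAt ℝ (w t) x)
    (hbal : ∀ t ∈ Ioo 0 τ, ∀ x ∈ Ω, ft t x + divg (w t) x = h t x)
    (hhc : ∀ t ∈ Ioo 0 τ, ContinuousOn (h t) Ω)
    (hf0 : ∀ t ∈ Icc 0 τ, ∀ x ∈ Ω, ρ t x = 0 → f t x = 0)
    (hw0 : ∀ t ∈ Ioo 0 τ, ∀ x ∈ Ω, ρ t x = 0 → w t x = 0)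
    (hh0 : ∀ t ∈ Ioo 0 τ, ∀ x ∈ Ω, ρ t x = 0 → h t x = 0) {t : ℝ} (ht : t ∈ Ioo 0 τ) :
    HasDerivAt (fun s => ∫ x in A s, f s x) (∫ x in A t, h t x) t := by
  have htI : t ∈ Icc 0 τ := Ioo_subset_Icc_self ht
  obtain ⟨χ, hχ, hcs, hsupp, hev⟩ := hA.exists_cutoff t htI
  have hn : Icc 0 τ ∈ 𝓝 t := Icc_mem_nhds ht.1 ht.2
  rw [nhdsWithin_eq_nhds.2 hn] at hev
  have hev' : (fun s => ∫ x in A s, f s x) =ᶠ[𝓝 t] fun s => ∫ x, χ x * f s x := by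
    filter_upwards [hev, hn] with s hs hsI
    exact setIntegral_eq_integral_cutoff_mul (hA.isCompact s hsI).measurableSet hs.1 hs.2
      fun x hx => hf0 s hsI x (hsupp hx)
  obtain ⟨hone, hvac⟩ := hev.self_of_nhds
  have hF : ContinuousOn (Function.uncurry fun s x => χ x * f s x) (Icc 0 τ ×ˢ univ) :=
    continuousOn_cutoff_mul hΩ hχ.continuous hsupp hfc
  have hF' : ContinuousOn (Function.uncurry fun s x => χ x * ft s x) (Ioo 0 τ ×ˢ univ) :=
    continuousOn_cutoff_mul hΩ hχ.continuous hsupp hftc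
  have hslice : ∀ {I : Set ℝ} {g : ℝ → Space d → ℝ},
      ContinuousOn (Function.uncurry g) (I ×ˢ univ) → ∀ s ∈ I, Continuous (g s) := by
    intro I g hg s hs
    rw [← continuousOn_univ]
    exact hg.comp (Continuous.prodMk continuous_const continuous_id :
      Continuous fun x : Space d => (s, x)).continuousOn fun x _ => ⟨hs, mem_univ x⟩
  -- Differentiation under the integral sign, with a constant bound on the support of `χ`.
  obtain ⟨r, hr, hrI⟩ := Metric.nhds_basis_closedBall.mem_iff.1 (Ioo_mem_nhds ht.1 ht.2)
  obtain ⟨C, hC⟩ := ((isCompact_closedBall t r).prod hcs).exists_bound_of_continuousOn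
    (hF'.mono (prod_mono hrI (subset_univ _)))
  have hder := (hasDerivAt_integral_of_dominated_loc_of_deriv_le (μ := volume)
    (F := fun s x => χ x * f s x) (F' := fun s x => χ x * ft s x)
    (bound := (tsupport χ).indicator fun _ => C) (Metric.closedBall_mem_nhds t hr)
    (by
      filter_upwards [hn] with s hs
      exact (hslice hF s hs).aestronglyMeasurable)
    ((hslice hF t htI).integrable_of_hasCompactSupport hcs.mul_right)
    (hslice hF' t ht).aestronglyMeasurable
    (Eventually.of_forall fun x s hs => by
      by_cases hx : x ∈ tsupport χ
      · rw [indicator_of_mem hx]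
        exact hC (s, x) ⟨hs, hx⟩
      · rw [indicator_of_notMem hx, image_eq_zero_of_notMem_tsupport hx]
        simp)
    ((integrable_indicator_iff hcs.isClosed.measurableSet).2
      (integrableOn_const hcs.measure_lt_top.ne))
    (Eventually.of_forall fun x s hs => by
      by_cases hx : x ∈ Ω
      · exact (hft s (hrI hs) x hx).const_mul (χ x)
      · have : χ x = 0 := image_eq_zero_of_notMem_tsupport fun h => hx (hsupp h)
        simpa [this] using hasDerivAt_const s (0 : ℝ))).2
  refine (hder.congr_of_eventuallyEq hev').congr_deriv ?_
  have hdivc : ContinuousOn (divg (w t)) Ω := by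
    have h1 : ContinuousOn (fun x => h t x - ft t x) Ω :=
      (hhc t ht).sub (hftc.comp (Continuous.prodMk continuous_const continuous_id :
        Continuous fun x : Space d => (t, x)).continuousOn fun x hx => ⟨ht, hx⟩)
    refine h1.congr fun x hx => ?_
    simp only [← hbal t ht x hx]
    ring
  -- The flux meets the gradient of the cutoff function only in the vacuum.
  have hgrad : ∀ x ∈ Ω, fderiv ℝ χ x (w t x) = 0 := by
    intro x hx
    by_cases hxA : x ∈ A t
    · rw [(hone x hxA).fderiv_eq]
      simp
    by_cases hxs : x ∈ tsupport χ
    · rw [hw0 t ht x hx (hvac x hxs hxA), map_zero]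
    · rw [fderiv_of_notMem_tsupport ℝ hxs]
      simp
  have hzero := integral_cutoff_mul_divg hΩ hχ hcs hsupp (hw t ht) hdivc hgrad
  rw [setIntegral_eq_integral_cutoff_mul (hA.isCompact t htI).measurableSet hone hvac
    fun x hx => hh0 t ht x (hsupp hx)]
  have hcut : ∀ {g : Space d → ℝ}, ContinuousOn g Ω → Integrable fun x => χ x * g x := by
    intro g hg
    have := continuousOn_cutoff_mul (X := ℝ) (I := univ) hΩ hχ.continuous hsupp
      (f := fun _ => g) (hg.comp continuous_snd.continuousOn fun p hp => hp.2)
    exact (hslice this 0 (mem_univ _)).integrable_of_hasCompactSupport hcs.mul_right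
  rw [← sub_zero (∫ x, χ x * h t x), ← hzero, ← integral_sub (hcut (hhc t ht)) (hcut hdivc)]
  refine integral_congr_ae (Eventually.of_forall fun x => ?_)
  by_cases hx : x ∈ Ω
  · simp only [← hbal t ht x hx]
    ring
  · have : χ x = 0 := image_eq_zero_of_notMem_tsupport fun h => hx (hsupp h)
    simp [this]

end IsIsolatedRegion

end IsolatedRegion

/-! ### The flow of a bounded Lipschitz field -/

/-- A bounded, globally Lipschitz, time-continuous field has a flow `Γ s x t` on `[0, τ]`, where
`Γ s x` is the trajectory through `x` at the time `s`; the label `Γ s x 0` depends continuously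
on `(s, x)`. -/
theorem exists_flow {E : Type*} [NormedAddCommGroup E] [NormedSpace ℝ E] [CompleteSpace E]
    {v : ℝ → E → E} {τ : ℝ} {K B : NNReal}
    (hK : ∀ t ∈ Icc 0 τ, LipschitzWith K (v t))
    (hc : ∀ x, ContinuousOn (fun t => v t x) (Icc 0 τ))
    (hB : ∀ t ∈ Icc 0 τ, ∀ x, ‖v t x‖ ≤ B) :
    ∃ Γ : ℝ → E → ℝ → E,
      (∀ s ∈ Icc 0 τ, ∀ x, Γ s x s = x ∧
        ∀ t ∈ Icc 0 τ, HasDerivWithinAt (Γ s x) (v t (Γ s x t)) (Icc 0 τ) t) ∧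
      ContinuousOn (Function.uncurry fun s x => Γ s x 0) (Icc 0 τ ×ˢ univ) := by
  have hPL : ∀ s : Icc 0 τ, ∀ x : E, ∀ r : NNReal,
      IsPicardLindelof v s x (B * Real.toNNReal τ + r) r B K := by
    intro s x r
    refine ⟨fun t ht => (hK t ht).lipschitzOnWith, fun x _ => hc x, fun t ht x _ => hB t ht x, ?_⟩
    have h1 : max (τ - (s : ℝ)) (s - 0) ≤ τ := max_le (by linarith [s.2.1]) (by linarith [s.2.2])
    have h2 : (Real.toNNReal τ : ℝ) = τ := Real.coe_toNNReal _ (s.2.1.trans s.2.2)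
    push_cast
    rw [h2, add_sub_cancel_right]
    exact mul_le_mul_of_nonneg_left h1 B.2
  choose! Γ hΓ using fun s (hs : s ∈ Icc 0 τ) x =>
    (hPL ⟨s, hs⟩ x 0).exists_eq_forall_mem_Icc_hasDerivWithinAt₀
  -- Trajectories that meet at some time have the same label.
  have huniq : ∀ s ∈ Icc 0 τ, ∀ f g : ℝ → E,
      (∀ t ∈ Icc 0 τ, HasDerivWithinAt f (v t (f t)) (Icc 0 τ) t) →
      (∀ t ∈ Icc 0 τ, HasDerivWithinAt g (v t (g t)) (Icc 0 τ) t) → f s = g s → f 0 = g 0 := by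
    intro s hs f g hf hg hfg
    have hsub : Icc 0 s ⊆ Icc 0 τ := Icc_subset_Icc_right hs.2
    have hleft : ∀ {f : ℝ → E}, (∀ t ∈ Icc 0 τ, HasDerivWithinAt f (v t (f t)) (Icc 0 τ) t) →
        ∀ t ∈ Ioc 0 s, HasDerivWithinAt f (v t (f t)) (Iic t) t := by
      intro f hf t ht
      refine ((hf t (hsub (Ioc_subset_Icc_self ht))).mono
        (Icc_subset_Icc_right (ht.2.trans hs.2))).mono_of_mem_nhdsWithin ?_
      exact Icc_mem_nhdsLE ht.1
    exact ODE_solution_unique_of_mem_Icc_left (s := fun _ => univ)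
      (fun t ht => (hK t (hsub (Ioc_subset_Icc_self ht))).lipschitzOnWith)
      (fun t ht => ((hf t (hsub ht)).continuousWithinAt).mono hsub) (hleft hf)
      (fun _ _ => mem_univ _)
      (fun t ht => ((hg t (hsub ht)).continuousWithinAt).mono hsub) (hleft hg)
      (fun _ _ => mem_univ _) hfg ⟨le_rfl, hs.1⟩
  refine ⟨Γ, hΓ, ?_⟩
  rintro ⟨s₀, x₀⟩ ⟨hs₀, -⟩
  have h0 : (0 : ℝ) ∈ Icc 0 τ := ⟨le_rfl, hs₀.1.trans hs₀.2⟩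
  obtain ⟨α, hα, L', hL'⟩ :=
    (hPL ⟨s₀, hs₀⟩ x₀ 1).exists_forall_mem_closedBall_eq_hasDerivWithinAt_lipschitzOnWith
  have hx₀ : x₀ ∈ Metric.closedBall x₀ ((1 : NNReal) : ℝ) := Metric.mem_closedBall_self (by simp)
  -- Slide `(s, x)` along its trajectory to the time `s₀`.
  have hmove : ∀ s ∈ Icc 0 τ, ∀ x, dist (Γ s x s₀) x₀ ≤ B * |s - s₀| + dist x x₀ := by
    intro s hs x
    have h1 := (convex_Icc 0 τ).norm_image_sub_le_of_norm_hasDerivWithin_le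
      (f := Γ s x) (f' := fun t => v t (Γ s x t)) (C := B) (fun t ht => (hΓ s hs x).2 t ht)
      (fun t ht => hB t ht _) hs hs₀
    rw [(hΓ s hs x).1, ← dist_eq_norm, Real.norm_eq_abs, abs_sub_comm] at h1
    linarith [dist_triangle (Γ s x s₀) x x₀]
  have heq : ∀ s ∈ Icc 0 τ, ∀ x, Γ s x s₀ ∈ Metric.closedBall x₀ ((1 : NNReal) : ℝ) →
      Γ s x 0 = α (Γ s x s₀) 0 := by
    intro s hs x hx
    exact huniq s₀ hs₀ _ _ (hΓ s hs x).2 (hα _ hx).2 (hα _ hx).1.symm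
  have hlim : Tendsto (fun p : ℝ × E => (B : ℝ) * |p.1 - s₀| + dist p.2 x₀)
      (𝓝[Icc 0 τ ×ˢ univ] (s₀, x₀)) (𝓝 0) := by
    have : Continuous fun p : ℝ × E => (B : ℝ) * |p.1 - s₀| + dist p.2 x₀ := by fun_prop
    simpa using (this.tendsto (s₀, x₀)).mono_left nhdsWithin_le_nhds
  have hlim' : Tendsto (fun p : ℝ × E => (L' : ℝ) * ((B : ℝ) * |p.1 - s₀| + dist p.2 x₀))
      (𝓝[Icc 0 τ ×ˢ univ] (s₀, x₀)) (𝓝 0) := by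
    simpa using hlim.const_mul (L' : ℝ)
  refine tendsto_iff_dist_tendsto_zero.2 (squeeze_zero' (Eventually.of_forall fun _ => dist_nonneg)
    ?_ hlim')
  filter_upwards [hlim.eventually (ge_mem_nhds one_pos), self_mem_nhdsWithin] with p hp hpI
  have hm := hmove p.1 hpI.1 p.2
  have hball : Γ p.1 p.2 s₀ ∈ Metric.closedBall x₀ ((1 : NNReal) : ℝ) := by
    simpa using hm.trans hp
  have hx₀' : Γ s₀ x₀ s₀ = x₀ := (hΓ s₀ hs₀ x₀).1
  simp only [Function.uncurry]
  rw [heq p.1 hpI.1 p.2 hball, heq s₀ hs₀ x₀ (by rw [hx₀']; exact hx₀), hx₀']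
  exact ((hL' 0 h0).dist_le_mul _ hball _ hx₀).trans (mul_le_mul_of_nonneg_left hm L'.2)

/-! ### Trajectories do not reach the boundary -/

/-- The direction from an interior point to a nearest boundary point is the outer normal there. -/
theorem isOuterUnitNormal_of_infDist_eq {Ω : Set (Space d)} (hΩ : IsSmoothBoundedDomain Ω)
    {x z : Space d} (hx : x ∈ Ω) (hz : z ∉ Ω) (hxz : Metric.infDist x Ωᶜ = dist x z) :
    z ∈ frontier Ω ∧ IsOuterUnitNormal Ω z (‖z - x‖⁻¹ • (z - x)) := by
  have hne : x ≠ z := fun h => hz (h ▸ hx)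
  have hpos : 0 < dist x z := dist_pos.2 hne
  have hball : Metric.ball x (dist x z) ⊆ Ω := by
    rw [← hxz]
    exact Metric.ball_infDist_compl_subset
  have hzf : z ∈ frontier Ω := by
    rw [hΩ.isOpen.frontier_eq]
    refine ⟨closure_mono hball ?_, hz⟩
    rw [closure_ball x hpos.ne', Metric.mem_closedBall, dist_comm]
  refine ⟨hzf, ?_⟩
  obtain ⟨φ, hφ⟩ := hΩ.smooth_boundary z hzf
  obtain ⟨hsm, hgrad, hev⟩ := hφ
  refine ⟨φ, ⟨hsm, hgrad, hev⟩, ?_⟩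
  set g := gradient φ z with hg
  set m := x - z with hm
  have hmn : 0 < ‖m‖ := norm_pos_iff.2 (sub_ne_zero.2 hne)
  have hφz : 0 ≤ φ z := not_lt.1 fun h => hz (hev.self_of_nhds.2 h)
  have hgd : HasGradientAt φ g z :=
    (hsm.differentiable (by simp) z).hasGradientAt
  -- Directions that point into the ball do not increase `φ`.
  have hdir : ∀ w : Space d, 0 < inner ℝ w m → inner ℝ g w ≤ 0 := by
    intro w hw
    have hline : HasDerivAt (fun ε : ℝ => z + ε • w) w 0 := by
      simpa using ((hasDerivAt_id (0 : ℝ)).smul_const w).const_add z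
    have hder : HasDerivAt (fun ε : ℝ => φ (z + ε • w)) (inner ℝ g w) 0 := by
      have h1 : HasFDerivAt φ (InnerProductSpace.toDual ℝ (Space d) g) (z + (0 : ℝ) • w) := by
        simpa using hgd.hasFDerivAt
      exact (h1.comp_hasDerivAt (0 : ℝ) hline).congr_deriv (by simp)
    have hslope := (hasDerivWithinAt_iff_tendsto_slope' (s := Ioi (0 : ℝ)) (by simp)).1
      hder.hasDerivWithinAt
    refine le_of_tendsto hslope ?_
    have hev' : ∀ᶠ ε : ℝ in 𝓝 0, (z + ε • w ∈ Ω ↔ φ (z + ε • w) < 0) := by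
      have : Tendsto (fun ε : ℝ => z + ε • w) (𝓝 0) (𝓝 z) := by
        simpa using hline.continuousAt.tendsto
      exact this.eventually hev
    have hsmall : ∀ᶠ ε : ℝ in 𝓝 0, ε * ‖w‖ ^ 2 < 2 * inner ℝ w m := by
      have : Tendsto (fun ε : ℝ => ε * ‖w‖ ^ 2) (𝓝 0) (𝓝 0) := by
        simpa using (tendsto_id (x := 𝓝 (0 : ℝ))).mul_const (‖w‖ ^ 2)
      exact this.eventually (gt_mem_nhds (by linarith))
    filter_upwards [mem_nhdsWithin_of_mem_nhds hev', mem_nhdsWithin_of_mem_nhds hsmall,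
      self_mem_nhdsWithin] with ε h1 h2 (h3 : 0 < ε)
    have hmem : z + ε • w ∈ Ω := by
      refine hball ?_
      rw [Metric.mem_ball, dist_comm, dist_eq_norm, dist_eq_norm]
      refine lt_of_pow_lt_pow_left₀ 2 (norm_nonneg _) ?_
      have : x - (z + ε • w) = m - ε • w := by rw [hm]; abel
      rw [this, norm_sub_sq_real, inner_smul_right, real_inner_comm, norm_smul, mul_pow,
        Real.norm_eq_abs, sq_abs]
      nlinarith
    have h4 := h1.1 hmem
    rw [slope_def_field]
    simp only [zero_smul, add_zero, sub_zero]
    exact div_nonpos_of_nonpos_of_nonneg (by linarith) h3.le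
  -- The part `w` of `g` orthogonal to `m` vanishes: test with `w + ε m`, `ε → 0`.
  set c := inner ℝ g m / ‖m‖ ^ 2 with hc
  set w := g - c • m with hw
  have hwm : inner ℝ w m = 0 := by
    rw [hw, inner_sub_left, inner_smul_left, real_inner_self_eq_norm_sq, hc]
    simp only [conj_trivial]
    field_simp
    ring
  have hgw : inner ℝ g w = ‖w‖ ^ 2 := by
    have : g = w + c • m := by rw [hw]; abel
    conv_lhs => rw [this]
    rw [inner_add_left, inner_smul_left, real_inner_comm w m, hwm, real_inner_self_eq_norm_sq]
    simp
  have hw0 : w = 0 := by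
    have h1 : ∀ ε : ℝ, 0 < ε → ‖w‖ ^ 2 + ε * inner ℝ g m ≤ 0 := by
      intro ε hε
      have := hdir (w + ε • m) (by
        rw [inner_add_left, hwm, inner_smul_left, real_inner_self_eq_norm_sq]
        simp only [conj_trivial]
        positivity)
      rwa [inner_add_right, hgw, inner_smul_right] at this
    have h2 : Tendsto (fun ε : ℝ => ‖w‖ ^ 2 + ε * inner ℝ g m) (𝓝[>] 0) (𝓝 (‖w‖ ^ 2)) := by
      have : Continuous fun ε : ℝ => ‖w‖ ^ 2 + ε * inner ℝ g m := by fun_prop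
      simpa using (this.tendsto 0).mono_left nhdsWithin_le_nhds
    have h3 := le_of_tendsto h2 (by filter_upwards [self_mem_nhdsWithin] with ε hε using h1 ε hε)
    have h4 : ‖w‖ = 0 := by nlinarith [norm_nonneg w]
    exact norm_eq_zero.1 h4
  have hgm : g = c • m := by rw [hw] at hw0; exact sub_eq_zero.1 hw0
  have hcneg : c < 0 := by
    have h1 : inner ℝ g m ≤ 0 := hdir m (by rw [real_inner_self_eq_norm_sq]; positivity)
    have h2 : c ≤ 0 := div_nonpos_of_nonpos_of_nonneg h1 (by positivity)
    refine lt_of_le_of_ne h2 fun h => hgrad ?_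
    rw [hgm, h, zero_smul]
  have hzx : z - x = -m := by rw [hm]; abel
  rw [hgm, hzx, norm_neg, norm_smul, Real.norm_eq_abs, abs_of_neg hcneg, smul_smul, smul_neg,
    ← neg_smul]
  congr 1
  have := hcneg.ne
  field_simp

/-- The velocity towards a nearest boundary point is at most the gradient bound times the
distance. -/
theorem neg_mul_dist_sq_le_inner {Ω : Set (Space d)} (hΩ : IsSmoothBoundedDomain Ω)
    {v : Space d → Space d} {L : ℝ} (hv : ∀ x ∈ Ω, DifferentiableAt ℝ v x)
    (hL : ∀ x ∈ Ω, ‖fderiv ℝ v x‖ ≤ L) (hvc : ContinuousOn v (closure Ω))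
    (hn : ∀ x ∈ frontier Ω, ∀ n, IsOuterUnitNormal Ω x n → inner ℝ (v x) n ≤ 0)
    {x z : Space d} (hx : x ∈ Ω) (hz : z ∉ Ω) (hxz : Metric.infDist x Ωᶜ = dist x z) :
    -L * dist x z ^ 2 ≤ inner ℝ (v x) (x - z) := by
  obtain ⟨hzf, hnor⟩ := isOuterUnitNormal_of_infDist_eq hΩ hx hz hxz
  have hpos : 0 < dist x z := dist_pos.2 fun h => hz (h ▸ hx)
  have hball : Metric.ball x (dist x z) ⊆ Ω := by
    rw [← hxz]
    exact Metric.ball_infDist_compl_subset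
  have hzcl : z ∈ closure (Metric.ball x (dist x z)) := by
    rw [closure_ball x hpos.ne', Metric.mem_closedBall, dist_comm]
  have hlip : ‖v z - v x‖ ≤ L * ‖z - x‖ := by
    have hbd : ∀ y ∈ Metric.ball x (dist x z), ‖v y - v x‖ ≤ L * ‖y - x‖ := fun y hy =>
      (convex_ball x (dist x z)).norm_image_sub_le_of_norm_fderiv_le
        (fun y hy => hv y (hball hy)) (fun y hy => hL y (hball hy))
        (Metric.mem_ball_self hpos) hy
    have hne : (𝓝[Metric.ball x (dist x z)] z).NeBot := mem_closure_iff_nhdsWithin_neBot.1 hzcl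
    have h1 : Tendsto v (𝓝[Metric.ball x (dist x z)] z) (𝓝 (v z)) :=
      (hvc z (frontier_subset_closure hzf)).mono (hball.trans subset_closure)
    have h2 : Tendsto (fun y : Space d => L * ‖y - x‖) (𝓝[Metric.ball x (dist x z)] z)
        (𝓝 (L * ‖z - x‖)) := by
      have : Continuous fun y : Space d => L * ‖y - x‖ := by fun_prop
      exact (this.tendsto z).mono_left nhdsWithin_le_nhds
    exact le_of_tendsto_of_tendsto (h1.sub_const (v x)).norm h2
      (by filter_upwards [self_mem_nhdsWithin] with y hy using hbd y hy)
  have hzn := hn z hzf _ hnor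
  have hzx : 0 < ‖z - x‖ := by rwa [← dist_eq_norm, dist_comm]
  rw [inner_smul_right] at hzn
  have h1 : inner ℝ (v z) (z - x) ≤ 0 :=
    nonpos_of_mul_nonpos_right hzn (inv_pos.2 hzx)
  have h2 : |inner ℝ (v z - v x) (z - x)| ≤ ‖v z - v x‖ * ‖z - x‖ := abs_real_inner_le_norm _ _
  have h3 : inner ℝ (v x) (x - z) = - inner ℝ (v x) (z - x) := by
    rw [← inner_neg_right, neg_sub]
  rw [h3, dist_comm, dist_eq_norm]
  rw [inner_sub_left] at h2
  have h4 := (abs_le.1 h2).1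
  nlinarith

/-- Along a curve whose velocity `V` satisfies `V · (Γ - z) ≥ -L |Γ - z|²` for the nearest points
`z` of a closed set, the distance to that set decays at most exponentially. The backward difference
quotients of the squared distance are controlled by a nearest point at the later time, so
Grönwall's inequality is applied with time reversed. -/
theorem infDist_sq_le_mul_exp {S : Set (Space d)} (hS : IsClosed S) (hne : S.Nonempty) {L τ : ℝ}
    {Γ V : ℝ → Space d} (hΓ : ∀ t ∈ Icc 0 τ, HasDerivWithinAt Γ (V t) (Icc 0 τ) t)
    (hV : ∀ t ∈ Icc 0 τ, ∀ z ∈ S, Metric.infDist (Γ t) S = dist (Γ t) z →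
      -L * dist (Γ t) z ^ 2 ≤ inner ℝ (V t) (Γ t - z)) {t : ℝ} (ht : t ∈ Icc 0 τ) :
    Metric.infDist (Γ 0) S ^ 2 ≤ Metric.infDist (Γ t) S ^ 2 * Real.exp (2 * L * t) := by
  have hsub : ∀ s ∈ Icc 0 t, t - s ∈ Icc 0 τ := fun s hs =>
    ⟨by linarith [hs.2], by linarith [hs.1, ht.2]⟩
  have hΓc : ContinuousOn Γ (Icc 0 τ) := fun s hs => (hΓ s hs).continuousWithinAt
  have key := le_gronwallBound_of_liminf_deriv_right_le
    (f := fun s => Metric.infDist (Γ (t - s)) S ^ 2)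
    (f' := fun s => 2 * L * Metric.infDist (Γ (t - s)) S ^ 2)
    (δ := Metric.infDist (Γ t) S ^ 2) (K := 2 * L) (ε := 0) (a := 0) (b := t)
    (((Metric.continuous_infDist_pt S).comp_continuousOn
      (hΓc.comp (by fun_prop) hsub)).pow 2) ?_ (by simp) (fun s _ => by simp) t ⟨ht.1, le_rfl⟩
  · simpa [gronwallBound_ε0] using key
  intro s hs r hr
  obtain ⟨z, hzS, hz⟩ := hS.exists_infDist_eq_dist hne (Γ (t - s))
  have hsI := hsub s (Ico_subset_Icc_self hs)
  have hin := hV _ hsI z hzS hz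
  let q : ℝ → ℝ := fun s => ‖Γ (t - s) - z‖ ^ 2
  have hq : HasDerivWithinAt q (2 * inner ℝ (Γ (t - s) - z) (-V (t - s))) (Ioi s) s := by
    have h1 : HasDerivWithinAt (fun s : ℝ => Γ (t - s)) (-V (t - s)) (Icc s t) s := by
      have hlin : HasDerivWithinAt (fun s : ℝ => t - s) (-1) (Icc s t) s := by
        simpa using ((hasDerivAt_id s).const_sub t).hasDerivWithinAt
      exact ((hΓ _ hsI).scomp s hlin fun y hy => hsub y ⟨hs.1.trans hy.1, hy.2⟩).congr_deriv
        (by simp)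
    have h2 := (h1.sub_const z).norm_sq
    exact (h2.mono_of_mem_nhdsWithin (Icc_mem_nhdsGE hs.2)).mono Ioi_subset_Ici_self
  have hslope := (hasDerivWithinAt_iff_tendsto_slope' (by simp)).1 hq
  have hlt : 2 * inner ℝ (Γ (t - s) - z) (-V (t - s)) < r := by
    rw [inner_neg_right, real_inner_comm]
    rw [hz] at hr
    linarith
  refine Eventually.frequently ?_
  filter_upwards [hslope.eventually (gt_mem_nhds hlt), self_mem_nhdsWithin] with y hy
    (hys : s < y)
  refine lt_of_le_of_lt ?_ hy
  rw [slope_def_field, div_eq_inv_mul]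
  refine mul_le_mul_of_nonneg_left ?_ (inv_nonneg.2 (sub_nonneg.2 hys.le))
  simp only [q]
  rw [hz, dist_eq_norm]
  have h1 : Metric.infDist (Γ (t - y)) S ≤ ‖Γ (t - y) - z‖ := by
    rw [← dist_eq_norm]
    exact Metric.infDist_le_dist_of_mem hzS
  have h2 := pow_le_pow_left₀ Metric.infDist_nonneg h1 2
  linarith

/-! ### The region occupied by the isolated mass -/

theorem exists_smooth_cutoff {K O : Set (Space d)} (hK : IsCompact K) (hO : IsOpen O)
    (hKO : K ⊆ O) :
    ∃ χ : Space d → ℝ, ContDiff ℝ ∞ χ ∧ HasCompactSupport χ ∧ tsupport χ ⊆ O ∧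
      (∀ x ∈ K, χ =ᶠ[𝓝 x] 1) ∧ ∀ x, χ x ∈ Icc 0 1 := by
  obtain ⟨C, hC, hKC, hCO⟩ := exists_compact_between hK hO hKO
  obtain ⟨f, hf1, hf0, hf⟩ := exists_contMDiffMap_one_nhds_of_subset_interior
    (n := (⊤ : ℕ∞)) (modelWithCornersSelf ℝ (Space d)) hK.isClosed hKC
  have hsupp : tsupport f ⊆ C := by
    refine closure_minimal (fun x hx => ?_) hC.isClosed
    by_contra h
    exact hx (hf0 x h)
  exact ⟨f, f.contMDiff.contDiff, hC.of_isClosed_subset (isClosed_tsupport _) hsupp,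
    hsupp.trans hCO, fun x hx => eventually_nhdsSet_iff_forall.1 hf1 x hx, hf⟩

/-- A velocity field on `Ω`, `0 ≤ t ≤ τ`, which is bounded and has a bounded spatial gradient, and
which does not point out of `Ω` on the boundary. -/
structure IsTransportField (Ω : Set (Space d)) (τ : ℝ) (B : NNReal)
    (u : ℝ → Space d → Space d) : Prop where
  differentiableAt : ∀ t ∈ Icc 0 τ, ∀ x ∈ Ω, DifferentiableAt ℝ (u t) x
  norm_le : ∀ t ∈ Icc 0 τ, ∀ x ∈ Ω, ‖u t x‖ ≤ B
  norm_fderiv_le : ∀ t ∈ Icc 0 τ, ∀ x ∈ Ω, ‖fderiv ℝ (u t) x‖ ≤ B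
  continuousOn_time : ∀ x ∈ Ω, ContinuousOn (fun t => u t x) (Icc 0 τ)
  continuousOn_closure : ∀ t ∈ Icc 0 τ, ContinuousOn (u t) (closure Ω)
  no_outflow : ∀ t ∈ Icc 0 τ, ∀ x ∈ frontier Ω, ∀ n, IsOuterUnitNormal Ω x n →
    inner ℝ (u t x) n ≤ 0

/-- `Γ` is a particle path of `u` in `Ω` on the time interval `[0, τ]`. -/
def IsTrajectory (Ω : Set (Space d)) (τ : ℝ) (u : ℝ → Space d → Space d) (Γ : ℝ → Space d) :
    Prop :=
  ∀ s ∈ Icc 0 τ, Γ s ∈ Ω ∧ HasDerivWithinAt Γ (u s (Γ s)) (Icc 0 τ) s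

section Region

variable {Ω : Set (Space d)} {τ : ℝ} {B : NNReal} {u : ℝ → Space d → Space d}

/-- There is a continuous map `Ψ` that, wherever its value `Ψ t x` lies in the compact set `K`,
gives the position at time `0` of the particle that is at `x` at the time `t`.

`Ψ` comes from the flow of `ψ • u` with a cutoff function `ψ`. The bound on the decay of the
distance to `Ωᶜ` is the same for all `ψ`, so that `ψ` can be chosen as `1` on a compact set which
no trajectory from `K` leaves before the time `τ`. -/
theorem exists_label (hΩ : IsSmoothBoundedDomain Ω) (hne : Ωᶜ.Nonempty)
    (hu : IsTransportField Ω τ B u) {K : Set (Space d)} (hK : IsCompact K) (hKΩ : K ⊆ Ω) :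
    ∃ Ψ : ℝ → Space d → Space d,
      ContinuousOn (Function.uncurry Ψ) (Icc 0 τ ×ˢ univ) ∧ (0 ≤ τ → ∀ x, Ψ 0 x = x) ∧
      ∀ t ∈ Icc 0 τ, ∀ x, Ψ t x ∈ K →
        ∃ Γ, IsTrajectory Ω τ u Γ ∧ Γ 0 = Ψ t x ∧ Γ t = x := by
  have hcl : IsClosed Ωᶜ := hΩ.isOpen.isClosed_compl
  have hpos : ∀ x ∈ Ω, 0 < Metric.infDist x Ωᶜ := fun x hx =>
    (hcl.notMem_iff_infDist_pos hne).1 fun h => h hx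
  obtain ⟨δ, hδ, hδK⟩ : ∃ δ > 0, ∀ x ∈ K, δ ≤ Metric.infDist x Ωᶜ := by
    rcases K.eq_empty_or_nonempty with rfl | hKne
    · exact ⟨1, one_pos, by simp⟩
    · obtain ⟨x, hx, hmin⟩ :=
        hK.exists_isMinOn hKne (Metric.continuous_infDist_pt Ωᶜ).continuousOn
      exact ⟨_, hpos x (hKΩ hx), fun y hy => hmin hy⟩
  set K₁ : Set (Space d) := {x | δ ^ 2 ≤ Metric.infDist x Ωᶜ ^ 2 * Real.exp (2 * B * τ)} with hK₁
  have hK₁Ω : K₁ ⊆ Ω := by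
    intro x hx
    by_contra h
    have h0 : Metric.infDist x Ωᶜ = 0 := Metric.infDist_zero_of_mem h
    simp only [hK₁, mem_ofPred_eq, h0] at hx
    nlinarith
  have hK₁c : IsCompact K₁ := by
    refine Metric.isCompact_of_isClosed_isBounded ?_ (hΩ.isBounded.subset hK₁Ω)
    exact isClosed_le continuous_const
      (((Metric.continuous_infDist_pt _).pow 2).mul continuous_const)
  obtain ⟨ψ, hψ, hψcs, hψΩ, hψ1, hψ01⟩ := exists_smooth_cutoff hK₁c hΩ.isOpen hK₁Ω
  have hψd : Differentiable ℝ ψ := hψ.differentiable (by simp)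
  obtain ⟨C, hC⟩ := (hψcs.fderiv ℝ).exists_bound_of_continuous (hψ.continuous_fderiv (by simp))
  have hC0 : 0 ≤ C := (norm_nonneg _).trans (hC 0)
  have hψ0 : ∀ x, x ∉ Ω → ψ x = 0 := fun x hx =>
    image_eq_zero_of_notMem_tsupport fun h => hx (hψΩ h)
  let v : ℝ → Space d → Space d := fun t x => ψ x • u t x
  have hvd : ∀ t ∈ Icc 0 τ, ∀ x, DifferentiableAt ℝ (v t) x ∧ ‖fderiv ℝ (v t) x‖ ≤ B + C * B := by
    intro t ht x
    by_cases hx : x ∈ Ω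
    · have h1 := (hψd x).hasFDerivAt.smul (hu.differentiableAt t ht x hx).hasFDerivAt
      refine ⟨h1.differentiableAt, ?_⟩
      have h2 : fderiv ℝ (v t) x = _ := h1.fderiv
      rw [h2]
      refine (norm_add_le _ _).trans (add_le_add ?_ ?_)
      · rw [norm_smul, Real.norm_eq_abs, abs_of_nonneg (hψ01 x).1]
        exact (mul_le_of_le_one_left (norm_nonneg _) (hψ01 x).2).trans
          (hu.norm_fderiv_le t ht x hx)
      · rw [ContinuousLinearMap.norm_smulRight_apply]
        exact mul_le_mul (hC x) (hu.norm_le t ht x hx) (norm_nonneg _) hC0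
    · have hx' : x ∈ (tsupport ψ)ᶜ := fun h => hx (hψΩ h)
      have hev : v t =ᶠ[𝓝 x] fun _ => 0 := by
        filter_upwards [(isClosed_tsupport ψ).isOpen_compl.mem_nhds hx'] with y hy
        simp [v, image_eq_zero_of_notMem_tsupport hy]
      refine ⟨(differentiableAt_const (0 : Space d)).congr_of_eventuallyEq hev, ?_⟩
      rw [hev.fderiv_eq]
      simp only [fderiv_fun_const, Pi.zero_apply, norm_zero]
      positivity
  obtain ⟨Γ, hΓ, hΓc⟩ := exists_flow (v := v) (τ := τ) (K := B + ⟨C, hC0⟩ * B) (B := B)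
    (fun t ht => lipschitzWith_of_nnnorm_fderiv_le (𝕜 := ℝ) (fun x => (hvd t ht x).1)
      fun x => by
        rw [← NNReal.coe_le_coe]
        exact (hvd t ht x).2)
    (fun x => by
      by_cases hx : x ∈ Ω
      · exact (hu.continuousOn_time x hx).const_smul (ψ x)
      · simp only [v, hψ0 x hx, zero_smul]
        exact continuousOn_const)
    (fun t ht x => by
      by_cases hx : x ∈ Ω
      · simp only [v]
        rw [norm_smul, Real.norm_eq_abs, abs_of_nonneg (hψ01 x).1]
        exact (mul_le_of_le_one_left (norm_nonneg _) (hψ01 x).2).trans (hu.norm_le t ht x hx)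
      · simp [v, hψ0 x hx])
  refine ⟨fun s x => Γ s x 0, hΓc, fun hτ x => (hΓ 0 ⟨le_rfl, hτ⟩ x).1, ?_⟩
  intro t ht x hx
  obtain ⟨hΓt, hder⟩ := hΓ t ht x
  refine ⟨Γ t x, fun s hs => ?_, rfl, hΓt⟩
  have hstay : Γ t x s ∈ K₁ := by
    have h1 := infDist_sq_le_mul_exp hcl hne (L := B) hder (fun r hr z hz hrz => by
      by_cases hin : Γ t x r ∈ Ω
      · have h2 := neg_mul_dist_sq_le_inner hΩ (hu.differentiableAt r hr)
          (hu.norm_fderiv_le r hr) (hu.continuousOn_closure r hr) (hu.no_outflow r hr) hin hz hrz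
        simp only [v]
        rw [inner_smul_left, conj_trivial]
        have h3 := hψ01 (Γ t x r)
        have h4 : 0 ≤ (B : ℝ) * dist (Γ t x r) z ^ 2 := by positivity
        nlinarith [h3.1, h3.2]
      · have h2 : dist (Γ t x r) z = 0 := by
          rw [← hrz]
          exact Metric.infDist_zero_of_mem hin
        have h3 : Γ t x r - z = 0 := sub_eq_zero.2 (dist_eq_zero.1 h2)
        simp [h2, h3]) hs
    have h2 : δ ^ 2 ≤ Metric.infDist (Γ t x 0) Ωᶜ ^ 2 :=
      pow_le_pow_left₀ hδ.le (hδK _ hx) 2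
    have h3 : Real.exp (2 * B * s) ≤ Real.exp (2 * B * τ) :=
      Real.exp_le_exp.2 (mul_le_mul_of_nonneg_left hs.2 (by positivity))
    exact h2.trans (h1.trans (mul_le_mul_of_nonneg_left h3 (by positivity)))
  refine ⟨hK₁Ω hstay, ?_⟩
  have h1 := hder s hs
  simp only [v] at h1
  rwa [(hψ1 _ hstay).eq_of_nhds, Pi.one_apply, one_smul] at h1

/-- If vacuum is preserved along trajectories, an isolated mass group is carried to an isolated
region: the particles that start in `closure V`. -/
theorem exists_isIsolatedRegion (hΩ : IsSmoothBoundedDomain Ω) (hne : Ωᶜ.Nonempty) (hτ : 0 ≤ τ)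
    (hu : IsTransportField Ω τ B u) {ρ₀ : Space d → ℝ} {U V : Set (Space d)}
    (hUV : IsIsolatedMassGroup Ω ρ₀ U V) {ρ : ℝ → Space d → ℝ}
    (hvac : ∀ Γ, IsTrajectory Ω τ u Γ → ρ₀ (Γ 0) = 0 → ∀ t ∈ Icc 0 τ, ρ t (Γ t) = 0) :
    ∃ A, IsIsolatedRegion Ω τ ρ A ∧ A 0 = closure V := by
  have hVU := hUV.closure_V_subset
  obtain ⟨Ψ, hΨc, hΨ0, hΨ⟩ := exists_label hΩ hne hu hUV.isBounded_U.isCompact_closure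
    hUV.closure_U_subset
  have hUc : U ⊆ closure U := subset_closure
  have hΨt : ∀ t ∈ Icc 0 τ, Continuous (Ψ t) := by
    intro t ht
    rw [← continuousOn_univ]
    exact hΨc.comp (Continuous.prodMk continuous_const continuous_id :
      Continuous fun x : Space d => (t, x)).continuousOn fun x _ => ⟨ht, mem_univ x⟩
  have hin : ∀ t ∈ Icc 0 τ, ∀ x, Ψ t x ∈ U → x ∈ Ω := by
    intro t ht x hx
    obtain ⟨Γ, hΓ, -, rfl⟩ := hΨ t ht x (hUc hx)
    exact (hΓ t ht).1
  have hclosed : ∀ t ∈ Icc 0 τ, IsClosed {x | Ψ t x ∈ closure V} := fun t ht =>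
    isClosed_closure.preimage (hΨt t ht)
  have hsub : ∀ t ∈ Icc 0 τ, {x | Ψ t x ∈ closure V} ⊆ Ω := fun t ht x hx =>
    hin t ht x (hVU hx)
  have hcomp : ∀ t ∈ Icc 0 τ, IsCompact {x | Ψ t x ∈ closure V} := fun t ht =>
    Metric.isCompact_of_isClosed_isBounded (hclosed t ht) (hΩ.isBounded.subset (hsub t ht))
  -- The conditions `Ψ t x ∈ O`, with `O` open, are stable in `t` uniformly for `x` in compact sets.
  have htube : ∀ t₀ ∈ Icc 0 τ, ∀ C O : Set (Space d), IsCompact C → IsOpen O →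
      (∀ x ∈ C, Ψ t₀ x ∈ O) → ∀ᶠ t in 𝓝[Icc 0 τ] t₀, ∀ x ∈ C, Ψ t x ∈ O := by
    intro t₀ ht₀ C O hC hO hCO
    rw [eventually_nhdsWithin_iff]
    have h1 := hC.eventually_forall_of_forall_eventually (x₀ := t₀)
      (P := fun t x => t ∈ Icc 0 τ → Ψ t x ∈ O) fun x hx => by
        have h2 := (hΨc (t₀, x) ⟨ht₀, mem_univ x⟩).eventually (hO.mem_nhds (hCO x hx))
        rw [eventually_nhdsWithin_iff] at h2
        filter_upwards [h2] with p hp hpI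
        exact hp ⟨hpI, mem_univ _⟩
    filter_upwards [h1] with t ht htI x hx using ht x hx htI
  refine ⟨fun t => {x | Ψ t x ∈ closure V}, ⟨hcomp, hsub, ?_⟩, ?_⟩
  · intro t₀ ht₀
    obtain ⟨χ, hχ, hcs, hsupp, hone, -⟩ := exists_smooth_cutoff (hcomp t₀ ht₀)
      (hUV.isOpen_U.preimage (hΨt t₀ ht₀)) fun x hx => hVU hx
    refine ⟨χ, hχ, hcs, hsupp.trans (hin t₀ ht₀), ?_⟩
    have hN : IsOpen {x | χ =ᶠ[𝓝 x] 1} := isOpen_setOfPred_eventually_nhds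
    have h1 := htube t₀ ht₀ (tsupport χ) U hcs hUV.isOpen_U hsupp
    have h2 := htube t₀ ht₀ (closure Ω \ {x | χ =ᶠ[𝓝 x] 1}) (closure V)ᶜ
      (hΩ.isBounded.isCompact_closure.diff hN) isClosed_closure.isOpen_compl
      fun x hx h => hx.2 (hone x h)
    filter_upwards [h1, h2, self_mem_nhdsWithin] with t ht1 ht2 htI
    refine ⟨fun x hx => ?_, fun x hxs hxA => ?_⟩
    · by_contra h
      exact ht2 x ⟨subset_closure (hsub t htI hx), h⟩ hx
    · have hxU := ht1 x hxs
      obtain ⟨Γ, hΓ, hΓ0, rfl⟩ := hΨ t htI x (hUc hxU)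
      refine hvac Γ hΓ ?_ t htI
      rw [hΓ0]
      exact hUV.vacuum _ ⟨hxU, fun h => hxA (subset_closure h)⟩
  · ext x
    simp [hΨ0 hτ]

end Region

/-! ### Regularity of classical solutions -/

section TimeInterval

variable {T : EReal}

theorem Icc_subset_timeInterval {τ : ℝ} (hτ : (τ : EReal) < T) : Icc 0 τ ⊆ timeInterval T :=
  fun t ht => ⟨ht.1, lt_of_le_of_lt (by exact_mod_cast ht.2) hτ⟩

theorem timeInterval_mem_nhds {τ t : ℝ} (hτ : (τ : EReal) < T) (ht : t ∈ Ioo 0 τ) :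
    timeInterval T ∈ 𝓝 t :=
  mem_of_superset (Icc_mem_nhds ht.1 ht.2) (Icc_subset_timeInterval hτ)

theorem uniqueDiffOn_timeInterval (hT : 0 < T) : UniqueDiffOn ℝ (timeInterval T) := by
  obtain ⟨τ, h0, hτ⟩ := EReal.lt_iff_exists_real_btwn.1 hT
  have h0' : (0 : ℝ) < τ := by exact_mod_cast h0
  refine uniqueDiffOn_convex (OrdConnected.convex ⟨fun x hx y hy z hz => ?_⟩) ⟨τ / 2, ?_⟩
  · exact ⟨hx.1.trans hz.1, lt_of_le_of_lt (by exact_mod_cast hz.2) hy.2⟩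
  · exact mem_interior_iff_mem_nhds.2
      (timeInterval_mem_nhds hτ ⟨by linarith, by linarith⟩)

end TimeInterval

theorem norm_le_of_C2Norm_le {Ω : Set (Space d)} {f : Space d → Space d} {C : NNReal}
    (h : C2Norm Ω f ≤ C) {x : Space d} (hx : x ∈ Ω) : ‖f x‖ ≤ C ∧ ‖fderiv ℝ f x‖ ≤ C := by
  have h1 : ENNReal.ofReal (‖f x‖ + ‖fderiv ℝ f x‖ + ‖fderiv ℝ (fderiv ℝ f) x‖) ≤ C :=
    (le_iSup₂ (f := fun x (_ : x ∈ Ω) =>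
      ENNReal.ofReal (‖f x‖ + ‖fderiv ℝ f x‖ + ‖fderiv ℝ (fderiv ℝ f) x‖)) x hx).trans h
  rw [← ENNReal.ofReal_coe_nnreal] at h1
  replace h1 := (ENNReal.ofReal_le_ofReal_iff C.coe_nonneg).1 h1
  have h2 := norm_nonneg (f x)
  have h3 := norm_nonneg (fderiv ℝ f x)
  have h4 := norm_nonneg (fderiv ℝ (fderiv ℝ f) x)
  constructor <;> linarith

theorem MemC2.exists_bound {Ω : Set (Space d)} {f : Space d → Space d} (h : MemC2 Ω f) :
    ∃ C : NNReal, ∀ x ∈ Ω, ‖f x‖ ≤ C ∧ ‖fderiv ℝ f x‖ ≤ C :=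
  ⟨(C2Norm Ω f).toNNReal, fun _ hx =>
    norm_le_of_C2Norm_le (ENNReal.coe_toNNReal h.2.ne).ge hx⟩

theorem MemC2.differentiableAt {Ω : Set (Space d)} (hΩ : IsOpen Ω) {f : Space d → Space d}
    (h : MemC2 Ω f) {x : Space d} (hx : x ∈ Ω) : DifferentiableAt ℝ f x :=
  (h.1.differentiableOn (by norm_num)).differentiableAt (hΩ.mem_nhds hx)

/-- Continuity of a family that is continuous in space and locally uniformly continuous in time. -/
theorem continuousOn_prod_of_uniform {E : Type*} [NormedAddCommGroup E] {I : Set ℝ}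
    {Ω : Set (Space d)} {g : ℝ → Space d → E} (hg : ∀ t ∈ I, ContinuousOn (g t) Ω)
    (hunif : ∀ t ∈ I, ∀ ε > 0, ∀ᶠ s in 𝓝[I] t, ∀ x ∈ Ω, ‖g s x - g t x‖ ≤ ε) :
    ContinuousOn (Function.uncurry g) (I ×ˢ Ω) := by
  rintro ⟨t, x⟩ ⟨ht, hx⟩
  refine Metric.tendsto_nhds.2 fun ε hε => ?_
  rw [nhdsWithin_prod_eq]
  have h1 := (hunif t ht (ε / 2) (by linarith)).prod_mk
    ((Metric.tendsto_nhds.1 (hg t ht x hx) (ε / 2) (by linarith)).and self_mem_nhdsWithin)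
  filter_upwards [h1] with p hp
  have h2 := hp.1 p.2 hp.2.2
  rw [← dist_eq_norm] at h2
  have h3 := hp.2.1
  simp only [Function.uncurry]
  linarith [dist_triangle (g p.1 p.2) (g t p.2) (g t x)]

section Velocity

variable {Ω : Set (Space d)} {T : EReal} {u v : ℝ → Space d → Space d}

/-- `v` is the time derivative of the curve `u` in `C²(Ω)`, and `v` is continuous. -/
def IsC2Derivative (Ω : Set (Space d)) (T : EReal) (u v : ℝ → Space d → Space d) : Prop :=
  (∀ t ∈ timeInterval T, MemC2 Ω (u t) ∧ MemC2 Ω (v t)) ∧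
    (∀ t ∈ timeInterval T,
      Tendsto (fun s => C2Norm Ω (fun x => (s - t)⁻¹ • (u s x - u t x) - v t x))
        (𝓝[timeInterval T \ {t}] t) (𝓝 0)) ∧
    (∀ t ∈ timeInterval T,
      Tendsto (fun s => C2Norm Ω (fun x => v s x - v t x)) (𝓝[timeInterval T] t) (𝓝 0))

theorem IsC2Derivative.hasDerivWithinAt (h : IsC2Derivative Ω T u v) {t : ℝ}
    (ht : t ∈ timeInterval T) {x : Space d} (hx : x ∈ Ω) :
    HasDerivWithinAt (fun s => u s x) (v t x) (timeInterval T) t := by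
  rw [hasDerivWithinAt_iff_tendsto_slope, tendsto_iff_norm_sub_tendsto_zero]
  refine Metric.tendsto_nhds.2 fun ε hε => ?_
  have h1 := (h.2.1 t ht).eventually (ge_mem_nhds (a := ((Real.toNNReal (ε / 2) : NNReal) : ℝ≥0∞))
    (by simpa using hε))
  filter_upwards [h1] with s hs
  have h2 := (norm_le_of_C2Norm_le hs hx).1
  rw [Real.coe_toNNReal _ (by linarith)] at h2
  rw [slope_def_module, Real.dist_eq, sub_zero, abs_norm]
  linarith

theorem IsC2Derivative.uniform (hΩ : IsOpen Ω) (h : IsC2Derivative Ω T u v) {t : ℝ}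
    (ht : t ∈ timeInterval T) {ε : ℝ} (hε : 0 < ε) :
    ∀ᶠ s in 𝓝[timeInterval T] t, ∀ x ∈ Ω,
      ‖u s x - u t x‖ ≤ ε ∧ ‖fderiv ℝ (u s) x - fderiv ℝ (u t) x‖ ≤ ε := by
  obtain ⟨M, hM⟩ := (h.1 t ht).2.exists_bound
  have h1 := (h.2.1 t ht).eventually (ge_mem_nhds (a := ((1 : NNReal) : ℝ≥0∞)) (by simp))
  rw [sdiff_eq, nhdsWithin_inter', eventually_inf_principal] at h1
  have h2 : ∀ᶠ s in 𝓝[timeInterval T] t, |s - t| * (1 + M) ≤ ε := by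
    have : Tendsto (fun s : ℝ => |s - t| * (1 + M)) (𝓝[timeInterval T] t) (𝓝 0) := by
      have hc : Continuous fun s : ℝ => |s - t| * (1 + M) := by fun_prop
      simpa using (hc.tendsto t).mono_left nhdsWithin_le_nhds
    exact this.eventually (ge_mem_nhds hε)
  filter_upwards [h1, h2, self_mem_nhdsWithin] with s hs1 hs2 hsI x hx
  by_cases hst : s = t
  · subst hst
    simp [hε.le]
  have hst' : s - t ≠ 0 := sub_ne_zero.2 hst
  obtain ⟨h3, h4⟩ := norm_le_of_C2Norm_le (hs1 (by simpa using hst)) hx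
  obtain ⟨h5, h6⟩ := hM x hx
  have hus := (h.1 s hsI).1.differentiableAt hΩ hx
  have hut := (h.1 t ht).1.differentiableAt hΩ hx
  have hvt := (h.1 t ht).2.differentiableAt hΩ hx
  have hder : fderiv ℝ (fun x => (s - t)⁻¹ • (u s x - u t x) - v t x) x
      = (s - t)⁻¹ • (fderiv ℝ (u s) x - fderiv ℝ (u t) x) - fderiv ℝ (v t) x :=
    (((hus.hasFDerivAt.sub hut.hasFDerivAt).const_smul (s - t)⁻¹).sub hvt.hasFDerivAt).fderiv
  rw [hder] at h4
  simp only [NNReal.coe_one] at h3 h4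
  have key : ∀ {F : Type _} [NormedAddCommGroup F] [NormedSpace ℝ F] (p q : F),
      ‖(s - t)⁻¹ • p - q‖ ≤ 1 → ‖q‖ ≤ M → ‖p‖ ≤ ε := by
    intro F _ _ p q h7 h8
    have h9 : p = (s - t) • (((s - t)⁻¹ • p - q) + q) := by
      rw [sub_add_cancel, smul_smul, mul_inv_cancel₀ hst', one_smul]
    rw [h9, norm_smul, Real.norm_eq_abs]
    exact (mul_le_mul_of_nonneg_left ((norm_add_le _ _).trans (add_le_add h7 h8))
      (abs_nonneg _)).trans hs2
  exact ⟨key _ _ h3 h5, key _ _ h4 h6⟩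

theorem IsC2Derivative.continuousOn (hΩ : IsOpen Ω) (h : IsC2Derivative Ω T u v) :
    ContinuousOn (Function.uncurry u) (timeInterval T ×ˢ Ω) :=
  continuousOn_prod_of_uniform (fun t ht => (h.1 t ht).1.1.continuousOn)
    fun _ ht _ hε => (h.uniform hΩ ht hε).mono fun _ hs x hx => (hs x hx).1

theorem IsC2Derivative.continuousOn_fderiv (hΩ : IsOpen Ω) (h : IsC2Derivative Ω T u v) :
    ContinuousOn (Function.uncurry fun t => fderiv ℝ (u t)) (timeInterval T ×ˢ Ω) :=
  continuousOn_prod_of_uniform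
    (fun t ht => (h.1 t ht).1.1.continuousOn_fderiv_of_isOpen hΩ (by norm_num))
    fun _ ht _ hε => (h.uniform hΩ ht hε).mono fun _ hs x hx => (hs x hx).2

theorem IsC2Derivative.continuousOn_deriv (h : IsC2Derivative Ω T u v) :
    ContinuousOn (Function.uncurry v) (timeInterval T ×ˢ Ω) := by
  refine continuousOn_prod_of_uniform (fun t ht => (h.1 t ht).2.1.continuousOn)
    fun t ht ε hε => ?_
  have h1 := (h.2.2 t ht).eventually (ge_mem_nhds (a := ((Real.toNNReal ε : NNReal) : ℝ≥0∞))
    (by simpa using hε))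
  filter_upwards [h1] with s hs x hx
  have h2 := (norm_le_of_C2Norm_le hs hx).1
  rwa [Real.coe_toNNReal _ hε.le] at h2

theorem IsC2Derivative.exists_bound (hΩ : IsOpen Ω) (h : IsC2Derivative Ω T u v) {τ : ℝ}
    (hτ : (τ : EReal) < T) :
    ∃ B : NNReal, ∀ t ∈ Icc 0 τ, ∀ x ∈ Ω, ‖u t x‖ ≤ B ∧ ‖fderiv ℝ (u t) x‖ ≤ B := by
  refine isCompact_Icc.induction_on
    (p := fun s => ∃ B : NNReal, ∀ t ∈ s, ∀ x ∈ Ω, ‖u t x‖ ≤ B ∧ ‖fderiv ℝ (u t) x‖ ≤ B)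
    ⟨0, by simp⟩ (fun s t hst ⟨B, hB⟩ => ⟨B, fun r hr => hB r (hst hr)⟩)
    (fun s t ⟨B, hB⟩ ⟨B', hB'⟩ => ⟨max B B', ?_⟩) fun t ht => ?_
  · rintro r (hr | hr) x hx
    · obtain ⟨h1, h2⟩ := hB r hr x hx
      exact ⟨h1.trans (by simp), h2.trans (by simp)⟩
    · obtain ⟨h1, h2⟩ := hB' r hr x hx
      exact ⟨h1.trans (by simp), h2.trans (by simp)⟩
  · have htI := Icc_subset_timeInterval hτ ht
    obtain ⟨M, hM⟩ := (h.1 t htI).1.exists_bound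
    have h1 := (h.uniform hΩ htI one_pos).filter_mono
      (nhdsWithin_mono t (Icc_subset_timeInterval hτ))
    refine ⟨_, h1, M + 1, fun s hs x hx => ?_⟩
    obtain ⟨h2, h3⟩ := hs x hx
    obtain ⟨h4, h5⟩ := hM x hx
    push_cast
    constructor
    · linarith [norm_sub_norm_le (u s x) (u t x)]
    · linarith [norm_sub_norm_le (fderiv ℝ (u s) x) (fderiv ℝ (u t) x)]

end Velocity

theorem pd_apply {f : Space d → Space d} {x : Space d} (hf : DifferentiableAt ℝ f x)
    (i j : Fin d) : pd j (fun y => f y i) x = fderiv ℝ f x (EuclideanSpace.single j 1) i := by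
  have h1 : HasFDerivAt (fun y => f y i)
      ((EuclideanSpace.proj i : Space d →L[ℝ] ℝ).comp (fderiv ℝ f x)) x :=
    (EuclideanSpace.proj i : Space d →L[ℝ] ℝ).hasFDerivAt.comp x hf.hasFDerivAt
  unfold pd
  rw [h1.fderiv]
  rfl

theorem abs_divg_le {f : Space d → Space d} {x : Space d} (hf : DifferentiableAt ℝ f x) {B : ℝ}
    (hB : ‖fderiv ℝ f x‖ ≤ B) : |divg f x| ≤ d * B := by
  unfold divg
  refine (Finset.abs_sum_le_sum_abs _ _).trans ?_
  have : ∀ i ∈ Finset.univ, |pd i (fun y => f y i) x| ≤ B := by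
    intro i _
    rw [pd_apply hf]
    have h1 := PiLp.norm_apply_le (fderiv ℝ f x (EuclideanSpace.single i 1)) i
    have h2 := (fderiv ℝ f x).le_opNorm (EuclideanSpace.single i 1)
    rw [PiLp.norm_single, norm_one, mul_one] at h2
    rw [← Real.norm_eq_abs]
    exact h1.trans (h2.trans hB)
  simpa using Finset.sum_le_card_nsmul _ _ _ this

namespace IsClassicalSolution

variable {Ω : Set (Space d)} {γ : ℝ} {μ lam : ℝ → ℝ} {ρ₀ : Space d → ℝ}
  {u₀ : Space d → Space d} {T : EReal} {ρ : ℝ → Space d → ℝ} {u : ℝ → Space d → Space d}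

theorem continuousOn_density (h : IsClassicalSolution Ω γ μ lam ρ₀ u₀ T ρ u) :
    ContinuousOn (Function.uncurry ρ) (timeInterval T ×ˢ Ω) :=
  h.density_regular.continuousOn

theorem differentiableAt_density (hΩ : IsOpen Ω) (h : IsClassicalSolution Ω γ μ lam ρ₀ u₀ T ρ u)
    {t : ℝ} (ht : t ∈ timeInterval T) {x : Space d} (hx : x ∈ Ω) :
    DifferentiableAt ℝ (ρ t) x := by
  have h1 := h.density_regular.differentiableOn (by norm_num) (t, x) ⟨ht, hx⟩
  have h2 : DifferentiableWithinAt ℝ (ρ t) Ω x :=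
    DifferentiableWithinAt.comp (t := timeInterval T ×ˢ Ω) (f := fun y : Space d => (t, y)) x h1
      ((differentiableAt_const t).prodMk differentiableAt_id).differentiableWithinAt
      fun y hy => ⟨ht, hy⟩
  exact h2.differentiableAt (hΩ.mem_nhds hx)

theorem hasDerivWithinAt_density (h : IsClassicalSolution Ω γ μ lam ρ₀ u₀ T ρ u)
    {t : ℝ} (ht : t ∈ timeInterval T) {x : Space d} (hx : x ∈ Ω) :
    HasDerivWithinAt (fun s => ρ s x) (derivWithin (fun s => ρ s x) (timeInterval T) t)
      (timeInterval T) t := by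
  have h1 := h.density_regular.differentiableOn (by norm_num) (t, x) ⟨ht, hx⟩
  have h2 : DifferentiableWithinAt ℝ (fun s => ρ s x) (timeInterval T) t :=
    DifferentiableWithinAt.comp (t := timeInterval T ×ˢ Ω) (f := fun s : ℝ => (s, x)) t h1
      (differentiableAt_id.prodMk (differentiableAt_const x)).differentiableWithinAt
      fun s hs => ⟨hs, hx⟩
  exact h2.hasDerivWithinAt

/-- The continuity equation in non-divergence form. -/
theorem continuity (hΩ : IsOpen Ω) (h : IsClassicalSolution Ω γ μ lam ρ₀ u₀ T ρ u)
    {t : ℝ} (ht : t ∈ timeInterval T) {x : Space d} (hx : x ∈ Ω) :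
    derivWithin (fun s => ρ s x) (timeInterval T) t + fderiv ℝ (ρ t) x (u t x)
      = -(ρ t x * divg (u t) x) := by
  obtain ⟨v, hv⟩ := h.velocity_regular
  have h1 := (h.solves t ht x hx).continuity_eq
  rw [divg_smul (h.differentiableAt_density hΩ ht hx) ((hv.1 t ht).1.differentiableAt hΩ hx)] at h1
  linarith

/-- The material derivative of the density along a particle path. -/
theorem hasDerivWithinAt_density_comp (hΩ : IsOpen Ω)
    (h : IsClassicalSolution Ω γ μ lam ρ₀ u₀ T ρ u) {τ : ℝ} (hτ : (τ : EReal) < T)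
    {Γ : ℝ → Space d} (hΓ : IsTrajectory Ω τ u Γ) {t : ℝ} (ht : t ∈ Icc 0 τ) :
    HasDerivWithinAt (fun s => ρ s (Γ s)) (-(ρ t (Γ t) * divg (u t) (Γ t))) (Icc 0 τ) t := by
  have hI := Icc_subset_timeInterval hτ
  have htI := hI ht
  obtain ⟨hx, hder⟩ := hΓ t ht
  have h1 := (h.density_regular.differentiableOn (by norm_num) (t, Γ t) ⟨htI, hx⟩).hasFDerivWithinAt
  set D := fderivWithin ℝ (fun p : ℝ × Space d => ρ p.1 p.2) (timeInterval T ×ˢ Ω) (t, Γ t)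
  have htime : HasDerivWithinAt (fun s => ρ s (Γ t)) (D (1, 0)) (timeInterval T) t :=
    h1.comp_hasDerivWithinAt (f := fun s : ℝ => (s, Γ t)) t
      ((hasDerivWithinAt_id t _).prodMk (hasDerivWithinAt_const t _ (Γ t))) fun s hs => ⟨hs, hx⟩
  have hspace : HasFDerivWithinAt (ρ t) (D.comp (ContinuousLinearMap.inr ℝ ℝ (Space d))) Ω (Γ t) :=
    HasFDerivWithinAt.comp (g := fun p : ℝ × Space d => ρ p.1 p.2) (t := timeInterval T ×ˢ Ω)
      (f := fun y : Space d => (t, y)) (Γ t) h1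
      (hasFDerivAt_prodMk_right t (Γ t)).hasFDerivWithinAt fun y hy => ⟨htI, hy⟩
  have hcurve : HasDerivWithinAt (fun s => ρ s (Γ s)) (D (1, u t (Γ t))) (Icc 0 τ) t :=
    h1.comp_hasDerivWithinAt (f := fun s : ℝ => (s, Γ s)) t
      ((hasDerivWithinAt_id t _).prodMk hder) fun s hs => ⟨hI hs, (hΓ s hs).1⟩
  refine hcurve.congr_deriv ?_
  rw [← h.continuity hΩ htI hx, htime.derivWithin (uniqueDiffOn_timeInterval h.time_pos t htI),
    (hspace.hasFDerivAt (hΩ.mem_nhds hx)).fderiv]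
  simp [← map_add]

theorem isTransportField (hΩ : IsOpen Ω) (h : IsClassicalSolution Ω γ μ lam ρ₀ u₀ T ρ u)
    {τ : ℝ} (hτ : (τ : EReal) < T) : ∃ B, IsTransportField Ω τ B u := by
  obtain ⟨v, hv⟩ := h.velocity_regular
  obtain ⟨B, hB⟩ := IsC2Derivative.exists_bound hΩ hv hτ
  have hI := Icc_subset_timeInterval hτ
  exact ⟨B, fun t ht x hx => (hv.1 t (hI ht)).1.differentiableAt hΩ hx,
    fun t ht x hx => (hB t ht x hx).1, fun t ht x hx => (hB t ht x hx).2,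
    fun x hx t ht => ((IsC2Derivative.hasDerivWithinAt hv (hI ht) hx).continuousWithinAt).mono hI,
    fun t ht => h.velocity_continuous t (hI ht), fun t ht => h.no_outflow t (hI ht)⟩

/-- Vacuum is preserved along particle paths. -/
theorem density_eq_zero (hΩ : IsOpen Ω) (h : IsClassicalSolution Ω γ μ lam ρ₀ u₀ T ρ u)
    {τ : ℝ} (hτ : (τ : EReal) < T) {Γ : ℝ → Space d} (hΓ : IsTrajectory Ω τ u Γ)
    (h0 : ρ₀ (Γ 0) = 0) {t : ℝ} (ht : t ∈ Icc 0 τ) : ρ t (Γ t) = 0 := by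
  obtain ⟨B, hB⟩ := h.isTransportField hΩ hτ
  have hzero : (0 : ℝ) ∈ Icc 0 τ := ⟨le_rfl, ht.1.trans ht.2⟩
  refine eq_zero_of_abs_deriv_le_mul_abs_self_of_eq_zero_right (f := fun s => ρ s (Γ s))
    (f' := fun s => -(ρ s (Γ s) * divg (u s) (Γ s))) (K := d * B) (a := 0) (b := τ)
    (fun s hs => (h.hasDerivWithinAt_density_comp hΩ hτ hΓ hs).continuousWithinAt)
    (fun s hs => ?_) ?_ (fun s hs => ?_) t ht
  · exact ((h.hasDerivWithinAt_density_comp hΩ hτ hΓ (Ico_subset_Icc_self hs)).mono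
      (Icc_subset_Icc_left hs.1)).mono_of_mem_nhdsWithin (Icc_mem_nhdsGE hs.2)
  · rw [h.initial_density _ (hΓ 0 hzero).1, h0]
  · have hsI := Ico_subset_Icc_self hs
    have h1 := abs_divg_le (hB.differentiableAt s hsI _ (hΓ s hsI).1)
      (hB.norm_fderiv_le s hsI _ (hΓ s hsI).1)
    rw [norm_neg, norm_mul, mul_comm]
    exact mul_le_mul_of_nonneg_right h1 (norm_nonneg _)

theorem exists_region (hΩ : IsSmoothBoundedDomain Ω) (hne : Ωᶜ.Nonempty)
    (h : IsClassicalSolution Ω γ μ lam ρ₀ u₀ T ρ u) {U V : Set (Space d)}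
    (hUV : IsIsolatedMassGroup Ω ρ₀ U V) {τ : ℝ} (hτ0 : 0 ≤ τ) (hτ : (τ : EReal) < T) :
    ∃ A, IsIsolatedRegion Ω τ ρ A ∧ A 0 = closure V := by
  obtain ⟨B, hB⟩ := h.isTransportField hΩ.isOpen hτ
  exact exists_isIsolatedRegion hΩ hne hτ0 hB hUV fun Γ hΓ h0 t ht =>
    h.density_eq_zero hΩ.isOpen hτ hΓ h0 ht

theorem continuousOn_density_deriv (hΩ : IsOpen Ω)
    (h : IsClassicalSolution Ω γ μ lam ρ₀ u₀ T ρ u) {τ : ℝ} (hτ : (τ : EReal) < T) :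
    ContinuousOn (Function.uncurry fun t x => derivWithin (fun s => ρ s x) (timeInterval T) t)
      (Ioo 0 τ ×ˢ Ω) := by
  have hI : Ioo 0 τ ⊆ timeInterval T := Ioo_subset_Icc_self.trans (Icc_subset_timeInterval hτ)
  have hO : IsOpen (Ioo 0 τ ×ˢ Ω) := isOpen_Ioo.prod hΩ
  have h1 : ContDiffOn ℝ 1 (fun p : ℝ × Space d => ρ p.1 p.2) (Ioo 0 τ ×ˢ Ω) :=
    h.density_regular.mono (prod_mono hI subset_rfl)
  have h2 := (h1.continuousOn_fderiv_of_isOpen hO le_rfl).clm_apply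
    (continuousOn_const (c := ((1 : ℝ), (0 : Space d))))
  refine h2.congr ?_
  rintro ⟨t, x⟩ ⟨ht, hx⟩
  have h3 := ((h1.differentiableOn (by norm_num)).differentiableAt
    (hO.mem_nhds ⟨ht, hx⟩)).hasFDerivAt
  have h4 : HasDerivAt (fun s => ρ s x)
      (fderiv ℝ (fun p : ℝ × Space d => ρ p.1 p.2) (t, x) (1, 0)) t :=
    h3.comp_hasDerivAt (f := fun s : ℝ => (s, x)) t ((hasDerivAt_id t).prodMk (hasDerivAt_const t x))
  exact h4.hasDerivWithinAt.derivWithin (uniqueDiffOn_timeInterval h.time_pos t (hI ht))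

end IsClassicalSolution

/-! ### Mass, moment of inertia and virial of an isolated region -/

theorem continuousOn_slice {E : Type*} [TopologicalSpace E] {I : Set ℝ} {Ω : Set (Space d)}
    {g : ℝ → Space d → E} (hg : ContinuousOn (Function.uncurry g) (I ×ˢ Ω)) {t : ℝ} (ht : t ∈ I) :
    ContinuousOn (g t) Ω :=
  hg.comp (Continuous.prodMk continuous_const continuous_id :
    Continuous fun x : Space d => (t, x)).continuousOn fun _ hx => ⟨ht, hx⟩

theorem continuousOn_pd {Ω : Set (Space d)} {v : Space d → Space d}
    (hd : ∀ x ∈ Ω, DifferentiableAt ℝ v x) (hc : ContinuousOn (fderiv ℝ v) Ω) (i j : Fin d) :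
    ContinuousOn (pd j fun y => v y i) Ω := by
  have h1 : ContinuousOn (fun x => fderiv ℝ v x (EuclideanSpace.single j 1) i) Ω :=
    (EuclideanSpace.proj i : Space d →L[ℝ] ℝ).continuous.comp_continuousOn
      (hc.clm_apply continuousOn_const)
  exact h1.congr fun x hx => pd_apply (hd x hx) i j

theorem continuousOn_divg {Ω : Set (Space d)} {v : Space d → Space d}
    (hd : ∀ x ∈ Ω, DifferentiableAt ℝ v x) (hc : ContinuousOn (fderiv ℝ v) Ω) :
    ContinuousOn (divg v) Ω :=
  continuousOn_finsetSum _ fun i _ => continuousOn_pd hd hc i i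

theorem strain_self (v : Space d → Space d) (i : Fin d) (x : Space d) :
    strain v i i x = pd i (fun y => v y i) x := by
  unfold strain
  ring

/-- The `i`-th row `ρ uᵢ u - Sᵢ` of the flux of momentum, where
`S = 2 μ(ρ) D(u) + (λ(ρ) div u - ρ^γ) I` is the stress tensor. -/
noncomputable def momentumFlux (γ : ℝ) (μ lam : ℝ → ℝ) (r : Space d → ℝ)
    (v : Space d → Space d) (i : Fin d) (x : Space d) : Space d :=
  WithLp.toLp 2 fun j => r x * v x i * v x j - 2 * μ (r x) * strain v i j x
    - if j = i then lam (r x) * divg v x - r x ^ γ else 0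

theorem hasFDerivAt_half_norm_sq (x : Space d) :
    HasFDerivAt (fun y : Space d => ‖y‖ ^ 2 / 2) (innerSL ℝ x) x := by
  have h1 := ((hasStrictFDerivAt_norm_sq (F := Space d) x).hasFDerivAt).const_mul (1 / 2 : ℝ)
  refine (h1.congr_fderiv ?_).congr_of_eventuallyEq (Eventually.of_forall fun y => ?_)
  · ext y
    simp
  · simp only
    ring

namespace IsClassicalSolution

variable {Ω : Set (Space d)} {γ : ℝ} {μ lam : ℝ → ℝ} {ρ₀ : Space d → ℝ}
  {u₀ : Space d → Space d} {T : EReal} {ρ : ℝ → Space d → ℝ} {u : ℝ → Space d → Space d}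
  {τ : ℝ} {A : ℝ → Set (Space d)}

theorem velocity_differentiableAt (hΩ : IsOpen Ω) (h : IsClassicalSolution Ω γ μ lam ρ₀ u₀ T ρ u)
    {t : ℝ} (ht : t ∈ timeInterval T) {x : Space d} (hx : x ∈ Ω) :
    DifferentiableAt ℝ (u t) x := by
  obtain ⟨v, hv⟩ := h.velocity_regular
  exact (hv.1 t ht).1.differentiableAt hΩ hx

theorem continuousOn_velocity (hΩ : IsOpen Ω) (h : IsClassicalSolution Ω γ μ lam ρ₀ u₀ T ρ u) :
    ContinuousOn (Function.uncurry u) (timeInterval T ×ˢ Ω) := by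
  obtain ⟨v, hv⟩ := h.velocity_regular
  exact IsC2Derivative.continuousOn hΩ hv

theorem continuousOn_fderiv_velocity (hΩ : IsOpen Ω)
    (h : IsClassicalSolution Ω γ μ lam ρ₀ u₀ T ρ u) {t : ℝ} (ht : t ∈ timeInterval T) :
    ContinuousOn (fderiv ℝ (u t)) Ω := by
  obtain ⟨v, hv⟩ := h.velocity_regular
  exact continuousOn_slice (IsC2Derivative.continuousOn_fderiv hΩ hv) ht

theorem continuousOn_divg_velocity (hΩ : IsOpen Ω)
    (h : IsClassicalSolution Ω γ μ lam ρ₀ u₀ T ρ u) {t : ℝ} (ht : t ∈ timeInterval T) :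
    ContinuousOn (divg (u t)) Ω :=
  continuousOn_divg (fun _ hx => h.velocity_differentiableAt hΩ ht hx)
    (h.continuousOn_fderiv_velocity hΩ ht)

theorem hasDerivAt_density (h : IsClassicalSolution Ω γ μ lam ρ₀ u₀ T ρ u)
    (hτ : (τ : EReal) < T) {t : ℝ} (ht : t ∈ Ioo 0 τ) {x : Space d} (hx : x ∈ Ω) :
    HasDerivAt (fun s => ρ s x) (derivWithin (fun s => ρ s x) (timeInterval T) t) t :=
  (h.hasDerivWithinAt_density (Icc_subset_timeInterval hτ (Ioo_subset_Icc_self ht)) hx).hasDerivAt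
    (timeInterval_mem_nhds hτ ht)

/-- The renormalized continuity equation `∂ₜ G(ρ) + div (G(ρ) u) = (G(ρ) - ρ G'(ρ)) div u`,
integrated over an isolated region. -/
theorem hasDerivAt_integral_comp_density (hΩ : IsOpen Ω)
    (h : IsClassicalSolution Ω γ μ lam ρ₀ u₀ T ρ u) (hτ : (τ : EReal) < T)
    (hA : IsIsolatedRegion Ω τ ρ A) {G G' : ℝ → ℝ} (hG : ∀ s, HasDerivAt G (G' s) s)
    (hG' : Continuous G') (hG0 : G 0 = 0) {t : ℝ} (ht : t ∈ Ioo 0 τ) :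
    HasDerivAt (fun s => ∫ x in A s, G (ρ s x))
      (∫ x in A t, (G (ρ t x) - ρ t x * G' (ρ t x)) * divg (u t) x) t := by
  have hI := Icc_subset_timeInterval hτ
  have hI' := Ioo_subset_Icc_self.trans hI
  have hGc : Continuous G := continuous_iff_continuousAt.2 fun s => (hG s).continuousAt
  have hρc := h.continuousOn_density
  have hGd : ∀ t ∈ Ioo 0 τ, ∀ x ∈ Ω,
      HasFDerivAt (fun y => G (ρ t y)) (G' (ρ t x) • fderiv ℝ (ρ t) x) x := fun t ht x hx =>
    (hG (ρ t x)).comp_hasFDerivAt x (h.differentiableAt_density hΩ (hI' ht) hx).hasFDerivAt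
  refine hA.hasDerivAt_integral hΩ (f := fun t x => G (ρ t x))
    (ft := fun t x => G' (ρ t x) * derivWithin (fun s => ρ s x) (timeInterval T) t)
    (h := fun t x => (G (ρ t x) - ρ t x * G' (ρ t x)) * divg (u t) x)
    (w := fun t x => G (ρ t x) • u t x) ?_ ?_ ?_ ?_ ?_ ?_ ?_ ?_ ?_ ht
  · exact hGc.comp_continuousOn (hρc.mono (prod_mono hI subset_rfl))
  · intro t ht x hx
    exact (hG (ρ t x)).comp t (h.hasDerivAt_density hτ ht hx)
  · exact (hG'.comp_continuousOn (hρc.mono (prod_mono hI' subset_rfl))).mul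
      (h.continuousOn_density_deriv hΩ hτ)
  · intro t ht x hx
    exact (hGd t ht x hx).differentiableAt.smul (h.velocity_differentiableAt hΩ (hI' ht) hx)
  · intro t ht x hx
    rw [divg_smul (hGd t ht x hx).differentiableAt (h.velocity_differentiableAt hΩ (hI' ht) hx),
      (hGd t ht x hx).fderiv]
    have hcont := h.continuity hΩ (hI' ht) hx
    simp only [smul_apply, smul_eq_mul]
    linear_combination G' (ρ t x) * hcont
  · intro t ht
    have h1 : ContinuousOn (ρ t) Ω := continuousOn_slice hρc (hI' ht)
    exact ((hGc.comp_continuousOn h1).sub (h1.mul (hG'.comp_continuousOn h1))).mul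
      (h.continuousOn_divg_velocity hΩ (hI' ht))
  · intro t _ x _ h0
    simp only [h0, hG0]
  · intro t _ x _ h0
    simp only [h0, hG0, zero_smul]
  · intro t _ x _ h0
    simp only [h0, hG0]
    ring

/-- The derivative of half the moment of inertia is the virial `∫ ρ u · x`. -/
theorem hasDerivAt_moment (hΩ : IsOpen Ω)
    (h : IsClassicalSolution Ω γ μ lam ρ₀ u₀ T ρ u) (hτ : (τ : EReal) < T)
    (hA : IsIsolatedRegion Ω τ ρ A) {t : ℝ} (ht : t ∈ Ioo 0 τ) :
    HasDerivAt (fun s => ∫ x in A s, ‖x‖ ^ 2 / 2 * ρ s x)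
      (∫ x in A t, ρ t x * inner ℝ (u t x) x) t := by
  have hI := Icc_subset_timeInterval hτ
  have hI' := Ioo_subset_Icc_self.trans hI
  have hρc := h.continuousOn_density
  have hw : ∀ t ∈ Ioo 0 τ, ∀ x ∈ Ω, DifferentiableAt ℝ (fun y => ρ t y • u t y) x :=
    fun t ht x hx => (h.differentiableAt_density hΩ (hI' ht) hx).smul
      (h.velocity_differentiableAt hΩ (hI' ht) hx)
  have hnc : Continuous fun p : ℝ × Space d => ‖p.2‖ ^ 2 / 2 := by fun_prop
  refine hA.hasDerivAt_integral hΩ (f := fun t x => ‖x‖ ^ 2 / 2 * ρ t x)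
    (ft := fun t x => ‖x‖ ^ 2 / 2 * derivWithin (fun s => ρ s x) (timeInterval T) t)
    (h := fun t x => ρ t x * inner ℝ (u t x) x)
    (w := fun t x => (‖x‖ ^ 2 / 2) • (ρ t x • u t x)) ?_ ?_ ?_ ?_ ?_ ?_ ?_ ?_ ?_ ht
  · exact hnc.continuousOn.mul (hρc.mono (prod_mono hI subset_rfl))
  · intro t ht x hx
    exact (h.hasDerivAt_density hτ ht hx).const_mul _
  · exact hnc.continuousOn.mul (h.continuousOn_density_deriv hΩ hτ)
  · intro t ht x hx
    exact (hasFDerivAt_half_norm_sq x).differentiableAt.smul (hw t ht x hx)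
  · intro t ht x hx
    rw [divg_smul (hasFDerivAt_half_norm_sq x).differentiableAt (hw t ht x hx),
      (hasFDerivAt_half_norm_sq x).fderiv]
    have hcont := (h.solves t (hI' ht) x hx).continuity_eq
    simp only [innerSL_apply_apply, inner_smul_right]
    rw [real_inner_comm (u t x) x]
    linear_combination ‖x‖ ^ 2 / 2 * hcont
  · intro t ht
    exact (continuousOn_slice hρc (hI' ht)).mul
      ((continuousOn_slice (h.continuousOn_velocity hΩ) (hI' ht)).inner continuousOn_id)
  · intro t _ x _ h0
    simp only [h0, mul_zero]
  · intro t _ x _ h0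
    simp only [h0, zero_smul, smul_zero]
  · intro t _ x _ h0
    simp only [h0, zero_mul]

section Virial

theorem continuousOn_comp_density (h : IsClassicalSolution Ω γ μ lam ρ₀ u₀ T ρ u) {g : ℝ → ℝ}
    (hg : ContinuousOn g (Ici 0)) {t : ℝ} (ht : t ∈ timeInterval T) :
    ContinuousOn (fun x => g (ρ t x)) Ω :=
  hg.comp (continuousOn_slice h.continuousOn_density ht) fun x hx => h.density_nonneg t ht x hx

theorem differentiableAt_momentumFlux (hΩ : IsOpen Ω)
    (h : IsClassicalSolution Ω γ μ lam ρ₀ u₀ T ρ u) (hγ : 1 < γ) {t : ℝ}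
    (ht : t ∈ timeInterval T) {x : Space d} (hx : x ∈ Ω) (i : Fin d) :
    DifferentiableAt ℝ (momentumFlux γ μ lam (ρ t) (u t) i) x ∧
      derivWithin (fun s => ρ s x * u s x i) (timeInterval T) t
        + divg (momentumFlux γ μ lam (ρ t) (u t) i) x = 0 := by
  have hs := h.solves t ht x hx
  have hρ := h.differentiableAt_density hΩ ht hx
  have hu := (differentiableAt_piLp 2).1 (h.velocity_differentiableAt hΩ ht hx)
  have hconv : ∀ j, DifferentiableAt ℝ (fun y => ρ t y * u t y i * u t y j) x := fun j =>
    (hρ.mul (hu i)).mul (hu j)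
  have hp : DifferentiableAt ℝ (fun y => ρ t y ^ γ) x := hρ.rpow_const (Or.inr hγ.le)
  have hdiag : ∀ j, DifferentiableAt ℝ
      (fun y => if j = i then lam (ρ t y) * divg (u t) y - ρ t y ^ γ else 0) x := by
    intro j
    by_cases hj : j = i
    · simp only [hj, if_true]
      exact hs.bulk_stress_differentiable.sub hp
    · simp [hj]
  have hcomp : ∀ j, DifferentiableAt ℝ
      (fun y => momentumFlux γ μ lam (ρ t) (u t) i y j) x := fun j =>
    ((hconv j).sub (hs.shear_stress_differentiable i j)).sub (hdiag j)
  refine ⟨(differentiableAt_piLp 2).2 hcomp, ?_⟩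
  have hpd : ∀ j, pd j (fun y => momentumFlux γ μ lam (ρ t) (u t) i y j) x
      = pd j (fun y => ρ t y * u t y i * u t y j) x
        - pd j (fun y => 2 * μ (ρ t y) * strain (u t) i j y) x
        - if j = i then pd i (fun y => lam (ρ t y) * divg (u t) y) x
            - pd i (fun y => ρ t y ^ γ) x else 0 := by
    intro j
    have h1 := (((hconv j).hasFDerivAt.sub
      (hs.shear_stress_differentiable i j).hasFDerivAt).sub (hdiag j).hasFDerivAt).fderiv
    have h2 : pd j (fun y => momentumFlux γ μ lam (ρ t) (u t) i y j) x = _ :=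
      congrArg (fun D : Space d →L[ℝ] ℝ => D (EuclideanSpace.single j 1)) h1
    rw [h2]
    simp only [sub_apply]
    congr 1
    by_cases hj : j = i
    · subst hj
      simp only [if_true]
      rw [fderiv_fun_sub hs.bulk_stress_differentiable hp]
      rfl
    · simp [hj]
  have hm := hs.momentum_eq i
  unfold divg
  rw [Finset.sum_congr rfl fun j _ => hpd j, Finset.sum_sub_distrib, Finset.sum_sub_distrib,
    Finset.sum_ite_eq' Finset.univ i]
  simp only [Finset.mem_univ, if_true]
  linarith

theorem continuousOn_momentumFlux_diag (hΩ : IsOpen Ω)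
    (h : IsClassicalSolution Ω γ μ lam ρ₀ u₀ T ρ u) (hγ : 1 < γ)
    (hμ : ContinuousOn μ (Ici 0)) (hlam : ContinuousOn lam (Ici 0)) {t : ℝ}
    (ht : t ∈ timeInterval T) (i : Fin d) :
    ContinuousOn (fun x => momentumFlux γ μ lam (ρ t) (u t) i x i) Ω := by
  have hr : ContinuousOn (ρ t) Ω := continuousOn_slice h.continuousOn_density ht
  have hproj : Continuous fun y : Space d => y i := by fun_prop
  have hui : ContinuousOn (fun x => u t x i) Ω :=
    hproj.comp_continuousOn (continuousOn_slice (h.continuousOn_velocity hΩ) ht)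
  have hp : ContinuousOn (fun s : ℝ => s ^ γ) (Ici 0) :=
    (Real.continuous_rpow_const (by linarith)).continuousOn
  have hst : ContinuousOn (strain (u t) i i) Ω :=
    (continuousOn_pd (fun _ hx => h.velocity_differentiableAt hΩ ht hx)
      (h.continuousOn_fderiv_velocity hΩ ht) i i).congr fun x _ => strain_self _ i x
  have h1 : ContinuousOn (fun x => ρ t x * u t x i * u t x i
      - 2 * μ (ρ t x) * strain (u t) i i x - (lam (ρ t x) * divg (u t) x - ρ t x ^ γ)) Ω :=
    (((hr.mul hui).mul hui).sub ((continuousOn_const.mul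
      (h.continuousOn_comp_density hμ ht)).mul hst)).sub
      (((h.continuousOn_comp_density hlam ht).mul
        (h.continuousOn_divg_velocity hΩ ht)).sub (h.continuousOn_comp_density hp ht))
  exact h1.congr fun x _ => by simp [momentumFlux]

/-- The contribution of the `i`-th coordinate to the virial identity. -/
theorem hasDerivAt_virial_component (hΩ : IsOpen Ω)
    (h : IsClassicalSolution Ω γ μ lam ρ₀ u₀ T ρ u) (hγ : 1 < γ)
    (hμ : ContinuousOn μ (Ici 0)) (hμ0 : μ 0 = 0) (hlam : ContinuousOn lam (Ici 0))
    (hlam0 : lam 0 = 0) (hτ : (τ : EReal) < T)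
    (hA : IsIsolatedRegion Ω τ ρ A) {t : ℝ} (ht : t ∈ Ioo 0 τ) (i : Fin d) :
    HasDerivAt (fun s => ∫ x in A s, x i * (ρ s x * u s x i))
      (∫ x in A t, momentumFlux γ μ lam (ρ t) (u t) i x i) t := by
  have hI := Icc_subset_timeInterval hτ
  have hI' := Ioo_subset_Icc_self.trans hI
  have hρc := h.continuousOn_density
  have huc := h.continuousOn_velocity hΩ
  obtain ⟨v, hv⟩ := h.velocity_regular
  have hvc := IsC2Derivative.continuousOn_deriv hv
  have hproj : ∀ j, Continuous fun y : Space d => y j := fun j => by fun_prop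
  have hxc : Continuous fun p : ℝ × Space d => p.2 i := by fun_prop
  have hder : ∀ t ∈ Ioo 0 τ, ∀ x ∈ Ω, HasDerivAt (fun s => ρ s x * u s x i)
      (derivWithin (fun s => ρ s x) (timeInterval T) t * u t x i + ρ t x * v t x i) t := by
    intro t ht x hx
    have h1 := (IsC2Derivative.hasDerivWithinAt hv (hI' ht) hx).hasDerivAt
      (timeInterval_mem_nhds hτ ht)
    have h2 : HasDerivAt (fun s => u s x i) (v t x i) t :=
      (EuclideanSpace.proj i : Space d →L[ℝ] ℝ).hasFDerivAt.comp_hasDerivAt t h1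
    exact (h.hasDerivAt_density hτ ht hx).mul h2
  have hvac : ∀ t, ∀ x, ρ t x = 0 → momentumFlux γ μ lam (ρ t) (u t) i x = 0 := by
    intro t x h0
    ext j
    simp [momentumFlux, h0, hμ0, hlam0, Real.zero_rpow (by linarith : γ ≠ 0)]
  have hxi : ∀ x : Space d, HasFDerivAt (fun y : Space d => y i)
      (EuclideanSpace.proj i : Space d →L[ℝ] ℝ) x := fun x =>
    (EuclideanSpace.proj i : Space d →L[ℝ] ℝ).hasFDerivAt
  refine hA.hasDerivAt_integral hΩ (f := fun t x => x i * (ρ t x * u t x i))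
    (ft := fun t x => x i *
      (derivWithin (fun s => ρ s x) (timeInterval T) t * u t x i + ρ t x * v t x i))
    (h := fun t x => momentumFlux γ μ lam (ρ t) (u t) i x i)
    (w := fun t x => x i • momentumFlux γ μ lam (ρ t) (u t) i x) ?_ ?_ ?_ ?_ ?_ ?_ ?_ ?_ ?_ ht
  · exact hxc.continuousOn.mul ((hρc.mul ((hproj i).comp_continuousOn huc)).mono
      (prod_mono hI subset_rfl))
  · intro t ht x hx
    exact (hder t ht x hx).const_mul _
  · have hmono : Ioo 0 τ ×ˢ Ω ⊆ timeInterval T ×ˢ Ω := prod_mono hI' subset_rfl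
    exact hxc.continuousOn.mul (((h.continuousOn_density_deriv hΩ hτ).mul
      (((hproj i).comp_continuousOn huc).mono hmono)).add
        ((hρc.mul ((hproj i).comp_continuousOn hvc)).mono hmono))
  · intro t ht x hx
    exact (hxi x).differentiableAt.smul (h.differentiableAt_momentumFlux hΩ hγ (hI' ht) hx i).1
  · intro t ht x hx
    obtain ⟨h1, h2⟩ := h.differentiableAt_momentumFlux hΩ hγ (hI' ht) hx i
    rw [(hder t ht x hx).hasDerivWithinAt.derivWithin
      (uniqueDiffOn_timeInterval h.time_pos t (hI' ht))] at h2
    rw [divg_smul (hxi x).differentiableAt h1, (hxi x).fderiv]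
    have h3 : (EuclideanSpace.proj i : Space d →L[ℝ] ℝ)
        (momentumFlux γ μ lam (ρ t) (u t) i x) = momentumFlux γ μ lam (ρ t) (u t) i x i := rfl
    rw [h3]
    linear_combination x i * h2
  · intro t ht
    exact h.continuousOn_momentumFlux_diag hΩ hγ hμ hlam (hI' ht) i
  · intro t _ x _ h0
    simp only [h0, zero_mul, mul_zero]
  · intro t _ x _ h0
    simp only [hvac t x h0, smul_zero]
  · intro t _ x _ h0
    simp only [hvac t x h0, PiLp.zero_apply]

/-- The virial identity. The viscous stress enters only through its trace, the viscous pressure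
`(2 μ(ρ) + d λ(ρ)) div u`. -/
theorem hasDerivAt_virial (hΩ : IsOpen Ω)
    (h : IsClassicalSolution Ω γ μ lam ρ₀ u₀ T ρ u) (hγ : 1 < γ)
    (hμ : ContinuousOn μ (Ici 0)) (hμ0 : μ 0 = 0) (hlam : ContinuousOn lam (Ici 0))
    (hlam0 : lam 0 = 0) (hτ : (τ : EReal) < T)
    (hA : IsIsolatedRegion Ω τ ρ A) {t : ℝ} (ht : t ∈ Ioo 0 τ) :
    HasDerivAt (fun s => ∫ x in A s, ρ s x * inner ℝ (u s x) x)
      (∫ x in A t, (ρ t x * ‖u t x‖ ^ 2 + d * ρ t x ^ γ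
        - (2 * μ (ρ t x) + d * lam (ρ t x)) * divg (u t) x)) t := by
  have hI := Icc_subset_timeInterval hτ
  have hint : ∀ s ∈ Icc 0 τ, ∀ g : Space d → ℝ, ContinuousOn g Ω → IntegrableOn g (A s) :=
    fun s hs g hg => (hg.mono (hA.subset s hs)).integrableOn_compact (hA.isCompact s hs)
  have hsum := HasDerivAt.fun_sum fun i (_ : i ∈ Finset.univ) =>
    h.hasDerivAt_virial_component hΩ hγ hμ hμ0 hlam hlam0 hτ hA ht i
  refine (hsum.congr_of_eventuallyEq ?_).congr_deriv ?_
  · filter_upwards [Ioo_mem_nhds ht.1 ht.2] with s hs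
    have hsI := Ioo_subset_Icc_self hs
    rw [← integral_finsetSum]
    · refine integral_congr_ae (Eventually.of_forall fun x => ?_)
      simp only [PiLp.inner_apply, Finset.mul_sum]
      refine Finset.sum_congr rfl fun i _ => ?_
      simp only [RCLike.inner_apply, conj_trivial]
      ring
    · intro i _
      refine hint s hsI _ ?_
      have hproj : Continuous fun y : Space d => y i := by fun_prop
      exact hproj.continuousOn.mul ((continuousOn_slice h.continuousOn_density (hI hsI)).mul
        (hproj.comp_continuousOn (continuousOn_slice (h.continuousOn_velocity hΩ) (hI hsI))))
  · have htI := Ioo_subset_Icc_self ht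
    rw [← integral_finsetSum]
    · refine integral_congr_ae (Eventually.of_forall fun x => ?_)
      simp only [momentumFlux, if_true, Finset.sum_sub_distrib, EuclideanSpace.norm_sq_eq,
        Real.norm_eq_abs, sq_abs, strain_self, Finset.sum_const, Finset.card_univ,
        Fintype.card_fin, nsmul_eq_mul, ← Finset.mul_sum]
      have h1 : ∑ i, ρ t x * u t x i * u t x i = ρ t x * ∑ i, u t x i ^ 2 := by
        rw [Finset.mul_sum]
        exact Finset.sum_congr rfl fun i _ => by ring
      rw [h1]
      unfold divg
      ring
    · intro i _
      exact hint t htI _ (h.continuousOn_momentumFlux_diag hΩ hγ hμ hlam (hI htI) i)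

end Virial

end IsClassicalSolution

/-! ### A potential for the viscous pressure -/

/-- For a nonnegative viscous pressure `P` and `η > 0` there is a `C¹` function `G` with
`s G' - G = max (P - η) 0`, bounded from below by a constant and from above by a continuous function,
both independent of `η`. By the renormalized continuity equation, `P(ρ) div u` is then up to an
error `η |div u|` the time derivative of `-∫ G(ρ)`.

`G(s) = s ∫₁ˢ max (P(σ) - η) 0 / σ² dσ`; subtracting `η` makes the integrand vanish near `0`, so
that `G` is `C¹` up to the vacuum for every continuous `P` with `P(0) = 0`. -/
theorem exists_viscous_potential {P : ℝ → ℝ} (hP : ContinuousOn P (Ici 0)) (hP0 : P 0 = 0)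
    (hPn : ∀ s, 0 ≤ s → 0 ≤ P s) :
    ∃ (C : ℝ) (H : ℝ → ℝ), 0 ≤ C ∧ Continuous H ∧ ∀ η > 0, ∃ G G' : ℝ → ℝ,
      (∀ s, HasDerivAt G (G' s) s) ∧ Continuous G' ∧ G 0 = 0 ∧
      ∀ s, 0 ≤ s → -C ≤ G s ∧ G s ≤ H s ∧ s * G' s - G s = max (P s - η) 0 := by
  let p : ℝ → ℝ := fun s => P (max s 0)
  have hpc : Continuous p := by
    rw [← continuousOn_univ]
    exact hP.comp (by fun_prop) fun s _ => le_max_right s 0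
  have hpn : ∀ s, 0 ≤ p s := fun s => hPn _ (le_max_right s 0)
  have hp : ∀ s, 0 ≤ s → p s = P s := fun s hs => by simp only [p, max_eq_left hs]
  obtain ⟨C, hC⟩ := (isCompact_Icc (a := (0 : ℝ)) (b := 1)).exists_bound_of_continuousOn
    hpc.continuousOn
  have hC0 : 0 ≤ C := (norm_nonneg _).trans (hC 0 (by simp))
  have hC' : ∀ s ∈ Icc (0 : ℝ) 1, p s ≤ C := fun s hs => (le_abs_self _).trans (hC s hs)
  refine ⟨C, fun s => s * ∫ σ in (1 : ℝ)..(max s 1), p σ, hC0, ?_, fun η hη => ?_⟩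
  · exact continuous_id.mul ((intervalIntegral.continuous_primitive
      (fun a b => hpc.intervalIntegrable a b) 1).comp (by fun_prop))
  let q : ℝ → ℝ := fun σ => max (p σ - η) 0 / σ ^ 2
  have hqn : ∀ σ, 0 ≤ q σ := fun σ => by positivity
  have hqp : ∀ σ, max (p σ - η) 0 ≤ p σ := fun σ => max_le (by linarith) (hpn σ)
  have hqc : Continuous q := by
    refine continuous_iff_continuousAt.2 fun σ => ?_
    by_cases hσ : σ = 0
    · subst hσ
      have hev : q =ᶠ[𝓝 0] fun _ => 0 := by
        have h0 : p 0 < η := by simpa [p, hP0] using hη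
        filter_upwards [(hpc.tendsto 0).eventually (gt_mem_nhds h0)] with s hs
        simp only [q]
        rw [max_eq_right (by linarith), zero_div]
      exact continuousAt_const.congr hev.symm
    · have h1 : Continuous fun σ => max (p σ - η) 0 := by fun_prop
      exact h1.continuousAt.div (by fun_prop) (pow_ne_zero 2 hσ)
  have hqi : ∀ a b, IntervalIntegrable q volume a b := fun a b => hqc.intervalIntegrable a b
  let Q : ℝ → ℝ := fun s => ∫ σ in (1 : ℝ)..s, q σ
  have hQ : ∀ s, HasDerivAt Q (q s) s := fun s =>
    intervalIntegral.integral_hasDerivAt_right (hqi 1 s)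
      hqc.aestronglyMeasurable.stronglyMeasurableAtFilter hqc.continuousAt
  have hQc : Continuous Q := continuous_iff_continuousAt.2 fun s => (hQ s).continuousAt
  refine ⟨fun s => s * Q s, fun s => Q s + s * q s, fun s => ?_, ?_, by simp, fun s hs => ?_⟩
  · exact ((hasDerivAt_id s).mul (hQ s)).congr_deriv (by simp)
  · exact hQc.add (continuous_id.mul hqc)
  refine ⟨?_, ?_, ?_⟩
  · rcases le_or_gt 1 s with h1 | h1
    · have : 0 ≤ Q s := intervalIntegral.integral_nonneg h1 fun σ _ => hqn σ
      nlinarith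
    rcases hs.eq_or_lt with rfl | hs'
    · simpa using hC0
    have hder : ∀ σ ∈ uIcc s 1, HasDerivAt (fun σ : ℝ => -C * σ⁻¹) (C / σ ^ 2) σ := by
      intro σ hσ
      rw [uIcc_of_le h1.le] at hσ
      have hσ0 : σ ≠ 0 := (hs'.trans_le hσ.1).ne'
      refine ((hasDerivAt_inv hσ0).const_mul (-C)).congr_deriv ?_
      field_simp
    have hci : IntervalIntegrable (fun σ : ℝ => C / σ ^ 2) volume s 1 := by
      refine ContinuousOn.intervalIntegrable (continuousOn_const.div (by fun_prop) ?_)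
      intro σ hσ
      rw [uIcc_of_le h1.le] at hσ
      exact pow_ne_zero 2 (hs'.trans_le hσ.1).ne'
    have hint := intervalIntegral.integral_eq_sub_of_hasDerivAt hder hci
    have hle : ∫ σ in s..1, q σ ≤ ∫ σ in s..1, C / σ ^ 2 := by
      refine intervalIntegral.integral_mono_on h1.le (hqi s 1) hci fun σ hσ => ?_
      have h2 : max (p σ - η) 0 ≤ C := (hqp σ).trans (hC' σ ⟨hs.trans hσ.1, hσ.2⟩)
      exact div_le_div_of_nonneg_right h2 (by positivity)
    rw [hint] at hle
    have hQs : Q s = -∫ σ in s..1, q σ := intervalIntegral.integral_symm s 1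
    have h3 : s * (-C * (1 : ℝ)⁻¹ - -C * s⁻¹) = C - C * s := by
      field_simp
      ring
    have h4 := mul_le_mul_of_nonneg_left hle hs
    rw [h3] at h4
    simp only [hQs]
    nlinarith
  · refine mul_le_mul_of_nonneg_left ?_ hs
    rcases le_or_gt 1 s with h1 | h1
    · rw [max_eq_left h1]
      refine intervalIntegral.integral_mono_on h1 (hqi 1 s) (hpc.intervalIntegrable 1 s)
        fun σ hσ => ?_
      refine (div_le_self (le_max_right _ _) ?_).trans (hqp σ)
      nlinarith [hσ.1]
    · rw [max_eq_right h1.le, intervalIntegral.integral_same]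
      have hQs : Q s = -∫ σ in s..1, q σ := intervalIntegral.integral_symm s 1
      have : 0 ≤ ∫ σ in s..1, q σ := intervalIntegral.integral_nonneg h1.le fun σ _ => hqn σ
      linarith
  · have h1 : s * (Q s + s * q s) - s * Q s = s ^ 2 * q s := by ring
    change s * (Q s + s * q s) - s * Q s = max (P s - η) 0
    rw [h1]
    simp only [q, hp s hs]
    rcases hs.eq_or_lt with rfl | hs'
    · simp [hP0, hη.le]
    · field_simp

/-! ### Blow-up -/

theorem le_of_hasDerivAt_nonneg {F F' : ℝ → ℝ} {τ : ℝ} (hc : ContinuousOn F (Icc 0 τ))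
    (hd : ∀ t ∈ Ioo 0 τ, HasDerivAt F (F' t) t) (hn : ∀ t ∈ Ioo 0 τ, 0 ≤ F' t) {t : ℝ}
    (ht : t ∈ Icc 0 τ) : F 0 ≤ F t := by
  refine monotoneOn_of_deriv_nonneg (convex_Icc 0 τ) hc ?_ ?_ ⟨le_rfl, ht.1.trans ht.2⟩ ht ht.1
  · rw [interior_Icc]
    exact fun s hs => (hd s hs).differentiableAt.differentiableWithinAt
  · rw [interior_Icc]
    intro s hs
    rw [(hd s hs).deriv]
    exact hn s hs

/-- The tangent-type bound by which mass and volume bound the internal energy from below. -/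
theorem rpow_sub_one_mul_sub_le {γ δ s : ℝ} (hγ : 1 < γ) (hδ : 0 < δ) (hs : 0 ≤ s) :
    δ ^ (γ - 1) * (s - δ) ≤ s ^ γ := by
  rcases le_or_gt δ s with h | h
  · have hs' : 0 < s := hδ.trans_le h
    have h1 : δ ^ (γ - 1) ≤ s ^ (γ - 1) := Real.rpow_le_rpow hδ.le h (by linarith)
    have h2 : s ^ γ = s ^ (γ - 1) * s := by
      rw [← Real.rpow_add_one hs'.ne']
      ring_nf
    rw [h2]
    exact mul_le_mul h1 (by linarith) (by linarith) (by positivity)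
  · have h1 : 0 ≤ δ ^ (γ - 1) := by positivity
    have h2 : 0 ≤ s ^ γ := by positivity
    nlinarith

namespace IsClassicalSolution

variable {Ω : Set (Space d)} {γ : ℝ} {μ lam : ℝ → ℝ} {ρ₀ : Space d → ℝ}
  {u₀ : Space d → Space d} {T : EReal} {ρ : ℝ → Space d → ℝ} {u : ℝ → Space d → Space d}
  {τ : ℝ} {A : ℝ → Set (Space d)}

theorem integral_density_eq (hΩ : IsOpen Ω)
    (h : IsClassicalSolution Ω γ μ lam ρ₀ u₀ T ρ u) (hτ : (τ : EReal) < T)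
    (hA : IsIsolatedRegion Ω τ ρ A) {t : ℝ} (ht : t ∈ Icc 0 τ) :
    ∫ x in A t, ρ t x = ∫ x in A 0, ρ 0 x := by
  have hc : ContinuousOn (fun t => ∫ x in A t, ρ t x) (Icc 0 τ) :=
    hA.continuousOn_integral hΩ
      (h.continuousOn_density.mono (prod_mono (Icc_subset_timeInterval hτ) subset_rfl))
      fun _ _ _ _ h0 => h0
  have hd : ∀ t ∈ Ioo 0 τ, HasDerivAt (fun t => ∫ x in A t, ρ t x) 0 t := fun t ht =>
    (h.hasDerivAt_integral_comp_density hΩ hτ hA (G := fun s => s) (G' := fun _ => 1)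
      (fun s => hasDerivAt_id s) continuous_const rfl ht).congr_deriv (by simp)
  refine le_antisymm ?_ (le_of_hasDerivAt_nonneg hc hd (fun _ _ => le_rfl) ht)
  have := le_of_hasDerivAt_nonneg (F := fun t => -∫ x in A t, ρ t x) (F' := fun _ => 0) hc.neg
    (fun t ht => (hd t ht).neg.congr_deriv (by simp)) (fun _ _ => le_rfl) ht
  linarith

/-- The virial grows at least linearly: the viscous pressure is, up to a small error, a time
derivative of a quantity that is bounded on one side, and the pressure is bounded below by mass
conservation. -/
theorem le_virial (hd : 0 < d) (hΩ : IsSmoothBoundedDomain Ω)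
    (h : IsClassicalSolution Ω γ μ lam ρ₀ u₀ T ρ u) (hγ : 1 < γ)
    (hμ : ContinuousOn μ (Ici 0)) (hμ0 : μ 0 = 0) (hlam : ContinuousOn lam (Ici 0))
    (hlam0 : lam 0 = 0) (hτ : (τ : EReal) < T) (hA : IsIsolatedRegion Ω τ ρ A)
    {C c vol : ℝ} {H : ℝ → ℝ} (hC : 0 ≤ C) (hHc : Continuous H)
    (hH : ∀ η > 0, ∃ G G' : ℝ → ℝ,
      (∀ s, HasDerivAt G (G' s) s) ∧ Continuous G' ∧ G 0 = 0 ∧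
      ∀ s, 0 ≤ s → -C ≤ G s ∧ G s ≤ H s ∧
        s * G' s - G s = max (2 * μ s + d * lam s - η) 0)
    (hP : ∀ s, 0 ≤ s → 0 ≤ 2 * μ s + d * lam s)
    (hvol : vol = volume.real Ω) (hc : 0 < c)
    (hcp : ∀ t ∈ Icc 0 τ, c ≤ ∫ x in A t, ρ t x ^ γ) {t : ℝ} (ht : t ∈ Icc 0 τ) :
    c / 2 * t + (∫ x in A 0, ρ 0 x * inner ℝ (u 0 x) x) - (∫ x in A 0, H (ρ 0 x)) - C * vol
      ≤ ∫ x in A t, ρ t x * inner ℝ (u t x) x := by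
  have hO := hΩ.isOpen
  have hI := Icc_subset_timeInterval hτ
  have hfin : volume Ω ≠ ⊤ := hΩ.isBounded.measure_lt_top.ne
  have hvol0 : 0 ≤ vol := hvol ▸ measureReal_nonneg
  have hAvol : ∀ s ∈ Icc 0 τ, volume.real (A s) ≤ vol := fun s hs =>
    hvol ▸ measureReal_mono (hA.subset s hs) hfin
  have hAm : ∀ s ∈ Icc 0 τ, MeasurableSet (A s) := fun s hs => (hA.isCompact s hs).measurableSet
  have hAfin : ∀ s ∈ Icc 0 τ, volume (A s) ≠ ⊤ := fun s hs =>
    (hA.isCompact s hs).measure_lt_top.ne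
  have hint : ∀ s ∈ Icc 0 τ, ∀ g : Space d → ℝ, ContinuousOn g Ω → IntegrableOn g (A s) :=
    fun s hs g hg => (hg.mono (hA.subset s hs)).integrableOn_compact (hA.isCompact s hs)
  obtain ⟨B, hB⟩ := h.isTransportField hO hτ
  set η : ℝ := c / (2 * (d * B * vol + 1)) with hη
  have hη0 : 0 < η := by positivity
  have hηs : η * (d * B * vol) ≤ c / 2 := by
    rw [hη, div_mul_eq_mul_div, div_le_div_iff₀ (by positivity) two_pos]
    nlinarith
  obtain ⟨G, G', hG, hG'c, hG0, hGb⟩ := hH η hη0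
  have hGc : Continuous G := continuous_iff_continuousAt.2 fun s => (hG s).continuousAt
  have hρc : ∀ s ∈ Icc 0 τ, ContinuousOn (ρ s) Ω := fun s hs =>
    continuousOn_slice h.continuousOn_density (hI hs)
  have huc : ∀ s ∈ Icc 0 τ, ContinuousOn (u s) Ω := fun s hs =>
    continuousOn_slice (h.continuousOn_velocity hO) (hI hs)
  have hρn : ∀ s ∈ Icc 0 τ, ∀ x ∈ A s, 0 ≤ ρ s x := fun s hs x hx =>
    h.density_nonneg s (hI hs) x (hA.subset s hs hx)
  let N : ℝ → ℝ := fun s => ∫ x in A s, ρ s x * inner ℝ (u s x) x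
  let S : ℝ → ℝ := fun s => ∫ x in A s, G (ρ s x)
  have hsubI : Icc 0 τ ×ˢ Ω ⊆ timeInterval T ×ˢ Ω := prod_mono hI subset_rfl
  have hNc : ContinuousOn N (Icc 0 τ) := hA.continuousOn_integral hO
    ((h.continuousOn_density.mono hsubI).mul
      (((h.continuousOn_velocity hO).mono hsubI).inner continuous_snd.continuousOn))
    fun s _ x _ h0 => by simp only [h0, zero_mul]
  have hSc : ContinuousOn S (Icc 0 τ) := hA.continuousOn_integral hO
    (hGc.comp_continuousOn (h.continuousOn_density.mono hsubI))
    fun s _ x _ h0 => by simp only [h0, hG0]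
  have hmono := le_of_hasDerivAt_nonneg (F := fun s => N s - S s - c / 2 * s)
    (F' := fun s => (∫ x in A s, (ρ s x * ‖u s x‖ ^ 2 + d * ρ s x ^ γ
      - (2 * μ (ρ s x) + d * lam (ρ s x)) * divg (u s) x))
      - (∫ x in A s, (G (ρ s x) - ρ s x * G' (ρ s x)) * divg (u s) x) - c / 2)
    ((hNc.sub hSc).sub (by fun_prop))
    (fun s hs => ((h.hasDerivAt_virial hO hγ hμ hμ0 hlam hlam0 hτ hA hs).sub
      (h.hasDerivAt_integral_comp_density hO hτ hA hG hG'c hG0 hs)).sub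
      (((hasDerivAt_id s).const_mul (c / 2)).congr_deriv (by ring)))
    (fun s hs => by
      have hsI := Ioo_subset_Icc_self hs
      have hdivc := h.continuousOn_divg_velocity hO (hI hsI)
      have hpc : ContinuousOn (fun x => ρ s x ^ γ) Ω :=
        (Real.continuous_rpow_const (by linarith)).comp_continuousOn (hρc s hsI)
      have hi1 := hint s hsI (fun x => ρ s x * ‖u s x‖ ^ 2 + d * ρ s x ^ γ
          - (2 * μ (ρ s x) + d * lam (ρ s x)) * divg (u s) x)
        ((((hρc s hsI).mul ((huc s hsI).norm.pow 2)).add (continuousOn_const.mul hpc)).sub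
          (((continuousOn_const.mul (h.continuousOn_comp_density hμ (hI hsI))).add
            (continuousOn_const.mul (h.continuousOn_comp_density hlam (hI hsI)))).mul hdivc))
      have hi2 := hint s hsI (fun x => (G (ρ s x) - ρ s x * G' (ρ s x)) * divg (u s) x)
        (((hGc.comp_continuousOn (hρc s hsI)).sub
          ((hρc s hsI).mul (hG'c.comp_continuousOn (hρc s hsI)))).mul hdivc)
      have hi3 := hint s hsI (fun x => ρ s x ^ γ) hpc
      have hi4 : IntegrableOn (fun _ : Space d => η * (d * B)) (A s) :=
        integrableOn_const (hAfin s hsI)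
      rw [← integral_sub hi1 hi2]
      have hle : ∫ x in A s, (ρ s x ^ γ - η * (d * B)) ≤
          ∫ x in A s, (ρ s x * ‖u s x‖ ^ 2 + d * ρ s x ^ γ
            - (2 * μ (ρ s x) + d * lam (ρ s x)) * divg (u s) x
            - (G (ρ s x) - ρ s x * G' (ρ s x)) * divg (u s) x) := by
        refine setIntegral_mono_on (hi3.sub hi4) (hi1.sub hi2) (hAm s hsI) fun x hx => ?_
        have hx0 := hρn s hsI x hx
        have hdiv := abs_divg_le (hB.differentiableAt s hsI x (hA.subset s hsI hx))
          (hB.norm_fderiv_le s hsI x (hA.subset s hsI hx))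
        have hpow : 0 ≤ ρ s x ^ γ := Real.rpow_nonneg hx0 γ
        have hkin : 0 ≤ ρ s x * ‖u s x‖ ^ 2 := by positivity
        have hd1 : (1 : ℝ) ≤ d := by exact_mod_cast hd
        -- The error of the approximate potential lies between `0` and `η`.
        set e := 2 * μ (ρ s x) + d * lam (ρ s x) + (G (ρ s x) - ρ s x * G' (ρ s x)) with he
        have hmax := (hGb _ hx0).2.2
        have he0 : 0 ≤ e := by
          have : max (2 * μ (ρ s x) + d * lam (ρ s x) - η) 0
              ≤ 2 * μ (ρ s x) + d * lam (ρ s x) := max_le (by linarith) (hP _ hx0)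
          linarith
        have he1 : e ≤ η := by
          have := le_max_left (2 * μ (ρ s x) + d * lam (ρ s x) - η) 0
          linarith
        have herr : e * divg (u s) x ≤ η * (d * B) :=
          (mul_le_mul_of_nonneg_left (le_abs_self _) he0).trans
            (mul_le_mul he1 hdiv (abs_nonneg _) hη0.le)
        have hsplit : ρ s x * ‖u s x‖ ^ 2 + d * ρ s x ^ γ
            - (2 * μ (ρ s x) + d * lam (ρ s x)) * divg (u s) x
            - (G (ρ s x) - ρ s x * G' (ρ s x)) * divg (u s) x
            = ρ s x * ‖u s x‖ ^ 2 + d * ρ s x ^ γ - e * divg (u s) x := by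
          rw [he]
          ring
        rw [hsplit]
        nlinarith
      rw [integral_sub hi3 hi4, setIntegral_const, smul_eq_mul] at hle
      have h1 := hcp s hsI
      have h2 : volume.real (A s) * (η * (d * B)) ≤ c / 2 := by
        refine (mul_le_mul_of_nonneg_right (hAvol s hsI) (by positivity)).trans ?_
        linarith
      linarith) ht
  have h0 : (0 : ℝ) ∈ Icc 0 τ := ⟨le_rfl, ht.1.trans ht.2⟩
  have hS0 : S 0 ≤ ∫ x in A 0, H (ρ 0 x) :=
    setIntegral_mono_on (hint 0 h0 _ (hGc.comp_continuousOn (hρc 0 h0)))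
      (hint 0 h0 _ (hHc.comp_continuousOn (hρc 0 h0))) (hAm 0 h0)
      fun x hx => (hGb _ (hρn 0 h0 x hx)).2.1
  have hSt : -(C * vol) ≤ S t := by
    have h1 : ∫ _ in A t, -C ≤ S t :=
      setIntegral_mono_on (integrableOn_const (hAfin t ht))
        (hint t ht _ (hGc.comp_continuousOn (hρc t ht))) (hAm t ht)
        fun x hx => (hGb _ (hρn t ht x hx)).1
    rw [setIntegral_const, smul_eq_mul] at h1
    have := mul_le_mul_of_nonneg_right (hAvol t ht) hC
    linarith
  simp only [N] at hmono
  linarith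

end IsClassicalSolution

/-- Blow-up for all continuous viscosities that vanish in the vacuum and have `2 μ + d λ ≥ 0`. -/
theorem exists_lifespan_bound (hd : 0 < d) {Ω : Set (Space d)} (hΩ : IsSmoothBoundedDomain Ω)
    {γ : ℝ} (hγ : 1 < γ) {μ lam : ℝ → ℝ} (hμ : ContinuousOn μ (Ici 0)) (hμ0 : μ 0 = 0)
    (hlam : ContinuousOn lam (Ici 0)) (hlam0 : lam 0 = 0)
    (hP : ∀ s, 0 ≤ s → 0 ≤ 2 * μ s + d * lam s)
    {ρ₀ : Space d → ℝ} {u₀ : Space d → Space d} {U V : Set (Space d)}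
    (hUV : IsIsolatedMassGroup Ω ρ₀ U V) :
    ∃ Tstar : ℝ, ∀ (T : EReal) (ρ : ℝ → Space d → ℝ) (u : ℝ → Space d → Space d),
      IsClassicalSolution Ω γ μ lam ρ₀ u₀ T ρ u → T ≤ (Tstar : EReal) := by
  have hne : Ωᶜ.Nonempty := by
    have : NeZero d := ⟨hd.ne'⟩
    rw [nonempty_compl]
    rintro rfl
    exact NormedSpace.unbounded_univ ℝ (Space d) hΩ.isBounded
  obtain ⟨C, H, hC, hHc, hH⟩ := exists_viscous_potential
    (P := fun s => 2 * μ s + d * lam s)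
    ((continuousOn_const.mul hμ).add (continuousOn_const.mul hlam)) (by simp [hμ0, hlam0]) hP
  obtain ⟨R, hR⟩ := hΩ.isBounded.subset_closedBall (0 : Space d)
  set vol := volume.real Ω with hvol
  have hvol0 : 0 ≤ vol := measureReal_nonneg
  set M := ∫ x in V, ρ₀ x with hM
  have hM0 : 0 < M := hUV.mass_pos
  set δ := M / (2 * (vol + 1)) with hδ
  have hδ0 : 0 < δ := by positivity
  have hδv : δ * vol ≤ M / 2 := by
    rw [hδ, div_mul_eq_mul_div, div_le_div_iff₀ (by positivity) two_pos]
    nlinarith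
  set c := δ ^ (γ - 1) * (M / 2) with hc
  have hc0 : 0 < c := by positivity
  set K := |∫ x in closure V, ρ₀ x * inner ℝ (u₀ x) x| + |∫ x in closure V, H (ρ₀ x)| + C * vol
    with hK
  have hK0 : 0 ≤ K := by positivity
  refine ⟨1 + 4 * (K + R ^ 2 * M) / c, fun T ρ u h => ?_⟩
  by_contra! hT
  obtain ⟨τ, hτ1, hτ⟩ := EReal.lt_iff_exists_real_btwn.1 hT
  have hτ1' : 1 + 4 * (K + R ^ 2 * M) / c < τ := by exact_mod_cast hτ1
  have hquot : 0 ≤ 4 * (K + R ^ 2 * M) / c := by positivity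
  have hτ0 : 0 ≤ τ := by linarith
  obtain ⟨A, hA, hA0⟩ := h.exists_region hΩ hne hUV hτ0 hτ
  have hO := hΩ.isOpen
  have hI := Icc_subset_timeInterval hτ
  have h0 : (0 : ℝ) ∈ Icc 0 τ := ⟨le_rfl, hτ0⟩
  have hVΩ : closure V ⊆ Ω :=
    hUV.closure_V_subset.trans (subset_closure.trans hUV.closure_U_subset)
  have hρc : ∀ s ∈ Icc 0 τ, ContinuousOn (ρ s) Ω := fun s hs =>
    continuousOn_slice h.continuousOn_density (hI hs)
  have hint : ∀ s ∈ Icc 0 τ, ∀ g : Space d → ℝ, ContinuousOn g Ω → IntegrableOn g (A s) :=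
    fun s hs g hg => (hg.mono (hA.subset s hs)).integrableOn_compact (hA.isCompact s hs)
  have hAm : ∀ s ∈ Icc 0 τ, MeasurableSet (A s) := fun s hs => (hA.isCompact s hs).measurableSet
  have hinit : ∀ g : Space d → ℝ, ∀ g₀ : Space d → ℝ, (∀ x ∈ Ω, g x = g₀ x) →
      ∫ x in A 0, g x = ∫ x in closure V, g₀ x := by
    intro g g₀ hg
    rw [hA0]
    exact setIntegral_congr_fun isClosed_closure.measurableSet fun x hx => hg x (hVΩ hx)
  have hmass : ∀ s ∈ Icc 0 τ, ∫ x in A s, ρ s x = M := by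
    intro s hs
    rw [h.integral_density_eq hO hτ hA hs, hinit (ρ 0) ρ₀ h.initial_density, hM]
    refine setIntegral_eq_of_subset_of_forall_sdiff_eq_zero isClosed_closure.measurableSet
      subset_closure fun x hx => hUV.vacuum x ⟨hUV.closure_V_subset hx.1, hx.2⟩
  have hcp : ∀ s ∈ Icc 0 τ, c ≤ ∫ x in A s, ρ s x ^ γ := by
    intro s hs
    have hpc : ContinuousOn (fun x => ρ s x ^ γ) Ω :=
      (Real.continuous_rpow_const (by linarith)).comp_continuousOn (hρc s hs)
    have hfin : volume (A s) ≠ ⊤ := (hA.isCompact s hs).measure_lt_top.ne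
    have hconst : IntegrableOn (fun _ : Space d => δ) (A s) := integrableOn_const hfin
    have h1 : ∫ x in A s, δ ^ (γ - 1) * (ρ s x - δ) ≤ ∫ x in A s, ρ s x ^ γ :=
      setIntegral_mono_on (((hint s hs _ (hρc s hs)).sub hconst).const_mul _) (hint s hs _ hpc)
        (hAm s hs) fun x hx => rpow_sub_one_mul_sub_le hγ hδ0
          (h.density_nonneg s (hI hs) x (hA.subset s hs hx))
    rw [integral_const_mul, integral_sub (hint s hs _ (hρc s hs)) hconst, hmass s hs,
      setIntegral_const, smul_eq_mul] at h1
    have h2 : volume.real (A s) * δ ≤ M / 2 := by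
      have hΩfin : volume Ω ≠ ⊤ := hΩ.isBounded.measure_lt_top.ne
      have := mul_le_mul_of_nonneg_right (measureReal_mono (hA.subset s hs) hΩfin) hδ0.le
      linarith
    exact (mul_le_mul_of_nonneg_left (by linarith) (by positivity)).trans h1
  have hN : ∀ t ∈ Icc 0 τ, c / 2 * t - K ≤ ∫ x in A t, ρ t x * inner ℝ (u t x) x := by
    intro t ht
    have h1 := h.le_virial hd hΩ hγ hμ hμ0 hlam hlam0 hτ hA hC hHc hH hP hvol hc0 hcp ht
    rw [hinit (fun x => ρ 0 x * inner ℝ (u 0 x) x) (fun x => ρ₀ x * inner ℝ (u₀ x) x)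
        (fun x hx => by simp only [h.initial_density x hx, h.initial_velocity x hx]),
      hinit (fun x => H (ρ 0 x)) (fun x => H (ρ₀ x))
        (fun x hx => by simp only [h.initial_density x hx])] at h1
    have h2 := neg_abs_le (∫ x in closure V, ρ₀ x * inner ℝ (u₀ x) x)
    have h3 := le_abs_self (∫ x in closure V, H (ρ₀ x))
    linarith
  -- The moment of inertia grows quadratically, but is bounded by the size of `Ω`.
  let J : ℝ → ℝ := fun s => ∫ x in A s, ‖x‖ ^ 2 / 2 * ρ s x
  have hnc : Continuous fun p : ℝ × Space d => ‖p.2‖ ^ 2 / 2 := by fun_prop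
  have hnc' : Continuous fun x : Space d => ‖x‖ ^ 2 / 2 := by fun_prop
  have hJc : ContinuousOn J (Icc 0 τ) := hA.continuousOn_integral hO
    (hnc.continuousOn.mul (h.continuousOn_density.mono (prod_mono hI subset_rfl)))
    fun s _ x _ h0 => by simp only [h0, mul_zero]
  have hmono := le_of_hasDerivAt_nonneg (F := fun s => J s - (c / 4 * s ^ 2 - K * s))
    (F' := fun s => (∫ x in A s, ρ s x * inner ℝ (u s x) x) - (c / 2 * s - K))
    (hJc.sub (by fun_prop))
    (fun s hs => (h.hasDerivAt_moment hO hτ hA hs).sub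
      (((((hasDerivAt_id s).pow 2).const_mul (c / 4)).sub
        ((hasDerivAt_id s).const_mul K)).congr_deriv (by simp; ring)))
    (fun s hs => sub_nonneg.2 (hN s (Ioo_subset_Icc_self hs)))
    (t := τ) ⟨hτ0, le_rfl⟩
  have hJ0 : 0 ≤ J 0 := setIntegral_nonneg (hAm 0 h0) fun x hx =>
    mul_nonneg (by positivity) (h.density_nonneg 0 (hI h0) x (hA.subset 0 h0 hx))
  have hτI : τ ∈ Icc 0 τ := ⟨hτ0, le_rfl⟩
  have hJτ : J τ ≤ R ^ 2 / 2 * M := by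
    rw [← hmass τ hτI, ← integral_const_mul]
    refine setIntegral_mono_on (hint τ hτI _ (hnc'.continuousOn.mul (hρc τ hτI)))
      ((hint τ hτI _ (hρc τ hτI)).const_mul _) (hAm τ hτI) fun x hx => ?_
    have hxΩ := hA.subset τ hτI hx
    have hxR : ‖x‖ ≤ R := mem_closedBall_zero_iff.1 (hR hxΩ)
    refine mul_le_mul_of_nonneg_right ?_ (h.density_nonneg τ (hI hτI) x hxΩ)
    have := pow_le_pow_left₀ (norm_nonneg x) hxR 2
    linarith
  have h1 : 4 * (K + R ^ 2 * M) < c * τ := by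
    have : 4 * (K + R ^ 2 * M) / c < τ := by linarith
    rw [div_lt_iff₀ hc0] at this
    linarith
  have h2 : 0 ≤ R ^ 2 * M := by positivity
  have h3 : 1 < τ := by linarith
  nlinarith

end BarotropicNS

theorem theorem1 (d : ℕ) (hd : 2 ≤ d)
    (Ω : Set (BarotropicNS.Space d)) (hΩ : BarotropicNS.IsSmoothBoundedDomain Ω)
    (γ a b α β : ℝ) (hγ : 1 < γ) (ha : 0 < a) (hab : 0 ≤ 2 * a + d * b)
    (μ lam : ℝ → ℝ) (hμ : μ = fun s => a * s ^ α) (hlam : lam = fun s => b * s ^ β)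
    (hvisc : ∀ s : ℝ, 0 ≤ s → 0 ≤ μ s ∧ 0 ≤ 2 * μ s + d * lam s)
    (ρ₀ : BarotropicNS.Space d → ℝ) (u₀ : BarotropicNS.Space d → BarotropicNS.Space d)
    (U V : Set (BarotropicNS.Space d)) (hUV : BarotropicNS.IsIsolatedMassGroup Ω ρ₀ U V)
    (hcond :
      (BarotropicNS.ConditionI d a b α β ∧ IntegrableOn ρ₀ V) ∨
      (BarotropicNS.ConditionII γ α β ∧ IntegrableOn ρ₀ V ∧
        IntegrableOn (BarotropicNS.energyDensity γ ρ₀ u₀) V) ∨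
      (BarotropicNS.ConditionIII d γ a b α β ∧ IntegrableOn ρ₀ V ∧
        IntegrableOn (BarotropicNS.energyDensity γ ρ₀ u₀) V ∧
        IntegrableOn (BarotropicNS.bdEntropyDensity γ μ ρ₀ u₀) V)) :
    ∃ Tstar : ℝ, ∀ (T : EReal) (ρ : ℝ → BarotropicNS.Space d → ℝ)
      (u : ℝ → BarotropicNS.Space d → BarotropicNS.Space d),
      BarotropicNS.IsClassicalSolution Ω γ μ lam ρ₀ u₀ T ρ u → T ≤ (Tstar : EReal) := by
  have hα : 0 < α := by
    rcases hcond with ⟨h, -⟩ | ⟨h, -⟩ | ⟨⟨-, ⟨κ, -, h⟩, -⟩, -⟩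
    · exact h.2.1
    · exact h.1.1
    · exact zero_lt_one.trans (hγ.trans h.1)
  have hβ : 0 < β := by
    rcases hcond with ⟨h, -⟩ | ⟨h, -⟩ | ⟨⟨h, -⟩, -⟩
    · exact h.1 ▸ h.2.1
    · exact h.2.1
    · exact h ▸ hα
  subst hμ hlam
  refine BarotropicNS.exists_lifespan_bound (by omega) hΩ hγ ?_ ?_ ?_ ?_
    (fun s hs => (hvisc s hs).2) hUV
  · exact (continuous_const.mul (Real.continuous_rpow_const hα.le)).continuousOn
  · simp [Real.zero_rpow hα.ne']
  · exact (continuous_const.mul (Real.continuous_rpow_const hβ.le)).continuousOn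
  · simp [Real.zero_rpow hβ.ne']
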